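/- Notation. For a finite poset $U$ and $n\ge 0$, $\mathrm{Sp}(U,n)$ is the largest $k$ such that the powerset of an $n$-element set, ordered by inclusion, has $k$ pairwise unrelated subposets isomorphic to $U$; two subposets are unrelated if every member of the first is incomparable with every member of the second. $\mathrm{FD}(r)$ is the free distributive lattice on $r$ generators, $\mathrm{Jir}(L)$ is the poset of join-irreducible elements of a finite lattice $L$ (elements with exactly one lower cover), and $\mathrm{FSP}(r,0,r)$ is the poset of the subsets $X$ of $\{1,\dots,r\}$ with $0<|X|<r$, ordered by inclusion. A function $f$ is a lower (upper) estimate of $\mathrm{Sp}(U,\cdot)$ on a set $S$ of integers if $f(n)\le\mathrm{Sp}(U,n)$ (respectively $\mathrm{Sp}(U,n)\le f(n)$) for all $n\in S$. A pair $(f_1,f_2)$ is separated on $S$, for $U$, if $f_1$ is a lower and $f_2$ an upper estimate of $\mathrm{Sp}(U,\cdot)$ on $S$ and $f_2(n)\le f_1(n+1)$ for all $n\in S$. With the convention that $\binom{x}{y}=0$ unless $0\le y\le x$, put, for $3\le r\le n$ and $p\in\mathbb Z$, $$f^{(p)}_{r0r}(n)=\sum_{i=0}^{\lfloor n/r\rfloor-1}\sum_{j=0}^{i}\binom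 ij\binom{n-(i+1)r}{p+\lfloor (n-r)/2\rfloor-jr},\qquad f_{r0r}=f^{(0)}_{r0r},\qquad g_r(n)=\Big\lfloor \tfrac12\tbinom{n+2-r}{\lfloor (n+2-r)/2\rfloor}\Big\rfloor .$$ For $n\ge3$ let $H_4(n)$ be the set of all $(t,x_1,x_2,x_3)\in\mathbb Z_{\ge 0}^4$ with $x_1,x_2,x_3>0$ and $t+x_1+x_2+x_3\le n$, and let $M_n$ be the minimum over $H_4(n)$ of $$\sum_{j}(t+x_j)!\,(n-t-x_j)!+\sum_{\{j,u\},\,j\ne u}(t+x_j+x_u)!\,(n-t-x_j-x_u)!-\sum_{(j,u),\,j\ne u}(t+x_j)!\,x_u!\,(n-t-x_j-x_u)!,$$ where $j,u$ range over $\{1,2,3\}$, the second sum is over two-element subsets and the third over ordered pairs. Put $g^*(n)=\lfloor n!/M_n\rfloor$ and $$g^{**}(n)=\Big\lfloor \frac{n!}{3\lfloor \frac n2\rfloor!\lceil \frac n2\rceil!+3\lfloor \frac{n+2}2\rfloor!\lceil \frac{n-2}2\rceil!-6\lfloor \frac n2\rfloor!\lceil \frac{n-2}2\rceil!}\Big\rfloor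 .$$ Theorem 4.1. Let $r\ge 3$. Then $\mathrm{Sp}(\mathrm{FSP}(r,0,r),n)=\mathrm{Sp}(\mathrm{Jir}(\mathrm{FD}(r)),n)$ for all $n\ge r$. For every $p\in\{-r,\dots,r\}$, $f^{(p)}_{r0r}$ is a lower estimate, and $g_r$ is an upper estimate, of $\mathrm{Sp}(\mathrm{Jir}(\mathrm{FD}(r)),\cdot)$ on $\{r,r+1,\dots\}$. In particular, $f_{r0r}(n)\le\mathrm{Sp}(\mathrm{Jir}(\mathrm{FD}(r)),n)\le g_r(n)$ for all $n\ge r$. For $r=3$, $g^*$ is also an upper estimate of $\mathrm{Sp}(\mathrm{Jir}(\mathrm{FD}(3)),\cdot)$ on $\{3,4,\dots\}$. For $3\le n\le 300$, $g^*(n)=g^{**}(n)\le g_3(n)$, and $g^{**}(n)<g_3(n)$ for $5\le n\le 300$. For $U=\mathrm{Jir}(\mathrm{FD}(3))$, the pair $(f_{303},g_3)$ is separated on $\{3,4,\dots\}$, and the pairs $(f_{303},g^{**})$ and $(f_{303},g^{*})$ are separated on $\{3,\dots,300\}$. Finally, for every $r\in\{3,\dots,100\}$ the pair $(f_{r0r},g_r)$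 is separated on $\{r,\dots,300\}$ for $U=\mathrm{Jir}(\mathrm{FD}(r))$. -/

import Mathlib

open scoped Nat

namespace SpernerFD

/-! ### Free distributive lattices and join-irreducible elements -/

/-- Lattice terms in the variables `x₀, …, x_{r-1}`. -/
inductive LatticeTerm (r : ℕ) : Type
  | var (i : Fin r) : LatticeTerm r
  | sup (s t : LatticeTerm r) : LatticeTerm r
  | inf (s t : LatticeTerm r) : LatticeTerm r

/-- The least congruence on lattice terms that contains all instances of the axioms of
distributive lattices. -/
inductive LatticeTerm.Equivalent {r : ℕ} : LatticeTerm r → LatticeTerm r → Prop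
  | refl (s) : Equivalent s s
  | symm {s t} : Equivalent s t → Equivalent t s
  | trans {s t u} : Equivalent s t → Equivalent t u → Equivalent s u
  | sup_congr {s s' t t'} :
      Equivalent s s' → Equivalent t t' → Equivalent (.sup s t) (.sup s' t')
  | inf_congr {s s' t t'} :
      Equivalent s s' → Equivalent t t' → Equivalent (.inf s t) (.inf s' t')
  | sup_comm (s t) : Equivalent (.sup s t) (.sup t s)
  | inf_comm (s t) : Equivalent (.inf s t) (.inf t s)
  | sup_assoc (s t u) : Equivalent (.sup (.sup s t) u) (.sup s (.sup t u))
  | inf_assoc (s t u) : Equivalent (.inf (.inf s t) u) (.inf s (.inf t u))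
  | sup_inf_self (s t) : Equivalent (.sup s (.inf s t)) s
  | inf_sup_self (s t) : Equivalent (.inf s (.sup s t)) s
  | inf_sup_left (s t u) : Equivalent (.inf s (.sup t u)) (.sup (.inf s t) (.inf s u))

/-- Equivalence of lattice terms modulo the axioms of distributive lattices. -/
def termSetoid (r : ℕ) : Setoid (LatticeTerm r) where
  r := LatticeTerm.Equivalent
  iseqv := ⟨.refl, .symm, .trans⟩

/-- The free distributive lattice on `r` generators (no top or bottom is adjoined). -/
def FD (r : ℕ) : Type := Quotient (termSetoid r)

namespace FD

variable {r : ℕ}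

/-- The free generators. -/
def gen (i : Fin r) : FD r := Quotient.mk (termSetoid r) (.var i)

/-- The join operation. -/
def sup : FD r → FD r → FD r :=
  Quotient.map₂ LatticeTerm.sup fun _ _ h _ _ h' => LatticeTerm.Equivalent.sup_congr h h'

/-- The meet operation. -/
def inf : FD r → FD r → FD r :=
  Quotient.map₂ LatticeTerm.inf fun _ _ h _ _ h' => LatticeTerm.Equivalent.inf_congr h h'

instance : DistribLattice (FD r) :=
  letI : Max (FD r) := ⟨sup⟩
  letI : Min (FD r) := ⟨inf⟩
  letI : Lattice (FD r) :=
    Lattice.mk'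
      (by rintro ⟨a⟩ ⟨b⟩; exact Quotient.sound (.sup_comm a b))
      (by rintro ⟨a⟩ ⟨b⟩ ⟨c⟩; exact Quotient.sound (.sup_assoc a b c))
      (by rintro ⟨a⟩ ⟨b⟩; exact Quotient.sound (.inf_comm a b))
      (by rintro ⟨a⟩ ⟨b⟩ ⟨c⟩; exact Quotient.sound (.inf_assoc a b c))
      (by rintro ⟨a⟩ ⟨b⟩; exact Quotient.sound (.sup_inf_self a b))
      (by rintro ⟨a⟩ ⟨b⟩; exact Quotient.sound (.inf_sup_self a b))
  DistribLattice.ofInfSupLe (by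
    rintro ⟨a⟩ ⟨b⟩ ⟨c⟩
    exact le_of_eq (Quotient.sound (LatticeTerm.Equivalent.inf_sup_left a b c)))

end FD

/-- The value of a lattice term in a lattice. -/
def LatticeTerm.eval {r : ℕ} {L : Type*} [Lattice L] (v : Fin r → L) : LatticeTerm r → L
  | .var i => v i
  | .sup s t => s.eval v ⊔ t.eval v
  | .inf s t => s.eval v ⊓ t.eval v

theorem LatticeTerm.Equivalent.eval_eq {r : ℕ} {L : Type*} [DistribLattice L] (v : Fin r → L)
    {s t : LatticeTerm r} (h : LatticeTerm.Equivalent s t) : s.eval v = t.eval v := by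
  induction h with
  | refl => rfl
  | symm _ ih => exact ih.symm
  | trans _ _ ih ih' => exact ih.trans ih'
  | sup_congr _ _ ih ih' => simp only [LatticeTerm.eval, ih, ih']
  | inf_congr _ _ ih ih' => simp only [LatticeTerm.eval, ih, ih']
  | sup_comm => exact _root_.sup_comm _ _
  | inf_comm => exact _root_.inf_comm _ _
  | sup_assoc => exact _root_.sup_assoc _ _ _
  | inf_assoc => exact _root_.inf_assoc _ _ _
  | sup_inf_self => exact _root_.sup_inf_self
  | inf_sup_self => exact _root_.inf_sup_self
  | inf_sup_left => exact _root_.inf_sup_left _ _ _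

/-- The universal property of `FD r`: every map from the generators to a distributive lattice
extends uniquely to a lattice homomorphism. -/
theorem FD.existsUnique_lift {r : ℕ} {L : Type*} [DistribLattice L] (v : Fin r → L) :
    ∃! f : LatticeHom (FD r) L, ∀ i, f (FD.gen i) = v i := by
  refine ⟨{ toFun := Quotient.lift (fun s => s.eval v) fun _ _ h =>
              LatticeTerm.Equivalent.eval_eq v h
            map_sup' := ?_
            map_inf' := ?_ }, fun i => rfl, ?_⟩
  · rintro ⟨a⟩ ⟨b⟩; rfl
  · rintro ⟨a⟩ ⟨b⟩; rfl
  · intro ψ hψ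
    ext ⟨a⟩
    change ψ (Quotient.mk (termSetoid r) a) = a.eval v
    induction a with
    | var i => exact hψ i
    | sup s t hs ht =>
      rw [LatticeTerm.eval, ← hs, ← ht]
      exact map_sup ψ (show FD r from Quotient.mk (termSetoid r) s)
        (show FD r from Quotient.mk (termSetoid r) t)
    | inf s t hs ht =>
      rw [LatticeTerm.eval, ← hs, ← ht]
      exact map_inf ψ (show FD r from Quotient.mk (termSetoid r) s)
        (show FD r from Quotient.mk (termSetoid r) t)

/-- The poset of join-irreducible elements of a (finite) lattice: the elements with exactly
one lower cover, with the order inherited from `L`. -/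
abbrev Jir (L : Type*) [Lattice L] : Type _ := {x : L // ∃! y : L, y ⋖ x}

/-! ### Unrelated copies of a poset in a powerset lattice -/

/-- `C` is a copy of the poset `U` in the powerset lattice of an `n`-element set. -/
def IsCopy (U : Type*) [PartialOrder U] {n : ℕ} (C : Finset (Finset (Fin n))) : Prop :=
  Nonempty (U ≃o {X : Finset (Fin n) // X ∈ C})

/-- Each member of `C` is incomparable with each member of `D`. -/
def Unrelated {n : ℕ} (C D : Finset (Finset (Fin n))) : Prop :=
  ∀ X ∈ C, ∀ Y ∈ D, ¬ X ⊆ Y ∧ ¬ Y ⊆ X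

/-- The numbers `k` such that there are `k` pairwise unrelated copies of `U` in the powerset
lattice of an `n`-element set. -/
def copyNumbers (U : Type*) [PartialOrder U] (n : ℕ) : Set ℕ :=
  {k | ∃ 𝒞 : Finset (Finset (Finset (Fin n))),
    𝒞.card = k ∧ (∀ C ∈ 𝒞, IsCopy U C) ∧ ∀ C ∈ 𝒞, ∀ D ∈ 𝒞, C ≠ D → Unrelated C D}

/-- `Sp(U, n)`, the maximum number of pairwise unrelated copies of `U` in the powerset lattice
of an `n`-element set. -/
noncomputable def Sp (U : Type*) [PartialOrder U] (n : ℕ) : ℕ := sSup (copyNumbers U n)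

/-- The supremum in the definition of `Sp` is a maximum. -/
theorem isGreatest_Sp (U : Type*) [PartialOrder U] (n : ℕ) :
    IsGreatest (copyNumbers U n) (Sp U n) := by
  have hb : BddAbove (copyNumbers U n) := by
    refine ⟨Fintype.card (Finset (Finset (Fin n))), ?_⟩
    rintro k ⟨𝒞, rfl, -⟩
    exact Finset.card_le_univ 𝒞
  have hne : (copyNumbers U n).Nonempty := ⟨0, ∅, by simp⟩
  exact ⟨Nat.sSup_mem hne hb, fun k hk => le_csSup hb hk⟩

/-- The full segment poset `FSP(r, a, b)`: the subsets `X` of an `r`-element set with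
`a < |X| < b`, ordered by inclusion. -/
abbrev FSP (r a b : ℕ) : Type := {X : Finset (Fin r) // a < X.card ∧ X.card < b}

/-- The number `r` is determined by the poset `FSP(r, 0, r)`: it is the least `m` such that the
poset embeds into the powerset lattice of an `m`-element set. -/
theorem isLeast_FSP (r : ℕ) (hr : 3 ≤ r) :
    IsLeast {m : ℕ | Nonempty (FSP r 0 r ↪o Finset (Fin m))} r := by
  refine ⟨⟨OrderEmbedding.subtype _⟩, ?_⟩
  rintro m ⟨f⟩
  have hA : ∀ i : Fin r, 0 < ({i} : Finset (Fin r)).card ∧ ({i} : Finset (Fin r)).card < r := by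
    intro i; rw [Finset.card_singleton]; omega
  have hB : ∀ i : Fin r, 0 < ({i}ᶜ : Finset (Fin r)).card ∧
      ({i}ᶜ : Finset (Fin r)).card < r := by
    intro i; rw [Finset.card_compl, Finset.card_singleton, Fintype.card_fin]; omega
  have h : ∀ i, ∃ e, e ∈ f ⟨{i}, hA i⟩ ∧ e ∉ f ⟨{i}ᶜ, hB i⟩ := by
    intro i
    have : ¬ f ⟨{i}, hA i⟩ ≤ f ⟨{i}ᶜ, hB i⟩ := by
      rw [f.le_iff_le]; simp
    exact Finset.not_subset.1 this
  choose e he he' using h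
  have hinj : Function.Injective e := by
    intro i j hij
    by_contra hne
    have hle : f ⟨{j}, hA j⟩ ≤ f ⟨{i}ᶜ, hB i⟩ := by
      rw [f.le_iff_le]
      simpa [eq_comm] using hne
    exact he' i (hij ▸ hle (he j))
  simpa using Fintype.card_le_of_injective e hinj

/-! ### Estimates -/

/-- `f` is a lower estimate of `Sp(U, -)` on `S`. -/
def IsLowerEstimateOn (U : Type*) [PartialOrder U] (f : ℕ → ℕ) (S : Set ℕ) : Prop :=
  ∀ n ∈ S, f n ≤ Sp U n

/-- `f` is an upper estimate of `Sp(U, -)` on `S`. -/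
def IsUpperEstimateOn (U : Type*) [PartialOrder U] (f : ℕ → ℕ) (S : Set ℕ) : Prop :=
  ∀ n ∈ S, Sp U n ≤ f n

/-- `(f₁, f₂)` is a separated pair of estimates of `Sp(U, -)` on `S`. -/
def IsSeparatedOn (U : Type*) [PartialOrder U] (f₁ f₂ : ℕ → ℕ) (S : Set ℕ) : Prop :=
  IsLowerEstimateOn U f₁ S ∧ IsUpperEstimateOn U f₂ S ∧ ∀ n ∈ S, f₂ n ≤ f₁ (n + 1)

/-- The binomial coefficient, with value `0` unless `0 ≤ y ≤ x`. -/
def binom (x y : ℤ) : ℕ := if 0 ≤ y ∧ y ≤ x then x.toNat.choose y.toNat else 0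

/-- The central binomial coefficient `binom(n, ⌊n/2⌋)`. -/
def fsp (n : ℕ) : ℕ := n.choose (n / 2)

/-- The lower estimate `f^{(p)}_{r,0,r}(n)`; the integer division by `2` rounds down. -/
def fLower (p : ℤ) (r n : ℕ) : ℕ :=
  ∑ i ∈ Finset.range (n / r), ∑ j ∈ Finset.range (i + 1),
    i.choose j * binom ((n : ℤ) - (i + 1) * r) (p + ((n : ℤ) - r) / 2 - j * r)

/-- The upper estimate `g_r(n) = ⌊fsp(n + 2 - r) / 2⌋` (used for `n ≥ r`). -/
def gUpper (r n : ℕ) : ℕ := fsp (n + 2 - r) / 2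

/-- The discrete simplex of all `(t, x)` with `x₁, x₂, x₃ > 0` and `t + x₁ + x₂ + x₃ ≤ n`. -/
def H4 (n : ℕ) : Set (ℕ × (Fin 3 → ℕ)) :=
  {q | (∀ j, 0 < q.2 j) ∧ q.1 + ∑ j, q.2 j ≤ n}

/-- The function on `H4 n` that counts permutations. The second sum is over the two-element
subsets `{j, u}` of the index set, the third one over the ordered pairs `(j, u)` with `j ≠ u`. -/
def F4 (n : ℕ) (t : ℕ) (x : Fin 3 → ℕ) : ℤ :=
  ∑ j : Fin 3, ((t + x j)! * (n - t - x j)! : ℤ)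
  + ∑ q : Fin 3 × Fin 3 with q.1 < q.2,
      ((t + x q.1 + x q.2)! * (n - t - x q.1 - x q.2)! : ℤ)
  - ∑ q : Fin 3 × Fin 3 with q.1 ≠ q.2,
      ((t + x q.1)! * (x q.2)! * (n - t - x q.1 - x q.2)! : ℤ)

/-- `M_n`, the minimum of `F4 n` on the nonempty finite set `H4 n` (for `n ≥ 3`). -/
noncomputable def M (n : ℕ) : ℤ := sInf ((fun q => F4 n q.1 q.2) '' H4 n)

/-- `g*(n) = ⌊n! / M_n⌋`. -/
noncomputable def gStar (n : ℕ) : ℕ := ⌊(n ! : ℚ) / (M n : ℚ)⌋₊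

/-- The closed form `g**(n)`, for `n ≥ 3`; here `(n + 1) / 2 = ⌈n/2⌉` and
`(n - 2 + 1) / 2 = ⌈(n-2)/2⌉`. -/
def gStarStar (n : ℕ) : ℕ :=
  ⌊(n ! : ℚ) * (3 * ((n / 2)! : ℚ) * (((n + 1) / 2)! : ℚ)
      + 3 * (((n + 2) / 2)! : ℚ) * (((n - 2 + 1) / 2)! : ℚ)
      - 6 * ((n / 2)! : ℚ) * (((n - 2 + 1) / 2)! : ℚ))⁻¹⌋₊

end SpernerFD

open SpernerFD

namespace SpernerFD

/-! ### Join-irreducible elements of free distributive lattices -/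

/-! The join-irreducibles of `FD r` are the meets of nonempty proper sets of generators, and such
meets are ordered by reverse inclusion. Complementation therefore gives `FSP r 0 r ≃o Jir (FD r)`,
and all estimates can be proved for `FSP r 0 r`.

Lower estimates: cut `Fin n` into blocks of length `r`. A copy lives in one block, over a base made
of whole earlier blocks and points after the block. Bases of one fixed size give pairwise unrelated
copies (`copyMember_unrelated`), and counting them yields the double sum.

Upper estimate `gUpper`: each copy contributes two intervals [atom, coatom]. The lower ends and the
complements of the upper ends form a cross-intersecting system of set pairs, to which Bollobás'
inequality applies.

Upper estimate `gStar`: count the numberings of the ground set having an initial segment that lies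
between two members of a copy. Initial segments of one numbering are comparable, so unrelated copies
use disjoint sets of numberings, and each copy uses at least `M n` of the `n !`. The minimum is
computed exactly: with G = ⌊n/2⌋!(n-1-⌊n/2⌋)!, it is 3(n-1)G for every n ≥ 3 (`minF4_le_F4`,
`F4_half`). This is also the denominator of `gStarStar`, and comparing it with `gUpper` becomes an
inequality about one central binomial coefficient.

Separation: the term i = j = 0 of `fLower 0 r (n + 1)` already dominates `gUpper r n`, by Pascal's
rule. -/

theorem FD.induction_on {r : ℕ} {P : FD r → Prop} (x : FD r) (gen : ∀ i, P (FD.gen i))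
    (sup : ∀ x y, P x → P y → P (x ⊔ y)) (inf : ∀ x y, P x → P y → P (x ⊓ y)) : P x := by
  obtain ⟨a⟩ := x
  induction a with
  | var i => exact gen i
  | sup s t hs ht => exact sup _ _ hs ht
  | inf s t hs ht => exact inf _ _ hs ht

/-- The meet of the generators with indices in a nonempty set. -/
def FD.meet {r : ℕ} (S : Finset (Fin r)) (hS : S.Nonempty) : FD r := S.inf' hS FD.gen

/-- The homomorphism to a powerset lattice that identifies `x` with the family of all `S` such
that the meet of the generators in `S` is below `x`. -/
noncomputable def FD.toSets (r : ℕ) : LatticeHom (FD r) (Set (Finset (Fin r))) :=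
  (FD.existsUnique_lift fun i => {S | i ∈ S}).choose

theorem FD.toSets_gen {r : ℕ} (i : Fin r) : FD.toSets r (FD.gen i) = {S | i ∈ S} :=
  (FD.existsUnique_lift fun i => {S : Finset (Fin r) | i ∈ S}).choose_spec.1 i

theorem FD.mem_toSets_meet {r : ℕ} {S T : Finset (Fin r)} (hT : T.Nonempty) :
    S ∈ FD.toSets r (FD.meet T hT) ↔ T ⊆ S := by
  unfold FD.meet
  induction hT using Finset.Nonempty.cons_induction with
  | singleton a => simp [FD.toSets_gen]
  | cons a s h hs ih =>
    rw [Finset.inf'_cons hs, map_inf]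
    refine (and_congr_right' ih).trans ?_
    rw [FD.toSets_gen]
    simp [Finset.insert_subset_iff]

theorem FD.meet_le_iff {r : ℕ} {S : Finset (Fin r)} (hS : S.Nonempty) (x : FD r) :
    FD.meet S hS ≤ x ↔ S ∈ FD.toSets r x := by
  constructor
  · intro h
    exact OrderHomClass.mono (FD.toSets r) h ((FD.mem_toSets_meet hS).2 subset_rfl)
  · induction x using FD.induction_on with
    | gen i =>
      rw [FD.toSets_gen]
      exact fun h => Finset.inf'_le _ h
    | sup x y hx hy =>
      rw [map_sup]
      rintro (h | h)
      · exact (hx h).trans le_sup_left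
      · exact (hy h).trans le_sup_right
    | inf x y hx hy =>
      rw [map_inf]
      exact fun h => le_inf (hx h.1) (hy h.2)

theorem FD.meet_le_meet_iff {r : ℕ} {S T : Finset (Fin r)} (hS : S.Nonempty) (hT : T.Nonempty) :
    FD.meet S hS ≤ FD.meet T hT ↔ T ⊆ S := by
  rw [FD.meet_le_iff, FD.mem_toSets_meet]

/-- Distributivity enters here. The extra factor `z` makes the induction pass through meets: while
one factor is decomposed, the other is absorbed into `z`. -/
theorem FD.inf_le_of_forall_meet {r : ℕ} (x : FD r) : ∀ z y : FD r,
    (∀ (S : Finset (Fin r)) (hS : S.Nonempty), FD.meet S hS ≤ x → FD.meet S hS ⊓ z ≤ y) →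
      x ⊓ z ≤ y := by
  induction x using FD.induction_on with
  | gen i =>
    intro z y h
    simpa [FD.meet] using h {i} (Finset.singleton_nonempty i) (by simp [FD.meet])
  | sup s t hs ht =>
    intro z y h
    rw [inf_sup_right]
    exact sup_le (hs z y fun S hS hle => h S hS (hle.trans le_sup_left))
      (ht z y fun S hS hle => h S hS (hle.trans le_sup_right))
  | inf s t hs ht =>
    intro z y h
    rw [inf_assoc]
    refine hs _ _ fun S hS hle => ?_
    rw [inf_left_comm]
    refine ht _ _ fun T hT hle' => ?_
    have hu := (hS.mono (Finset.subset_union_left (s₂ := T)))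
    have hST : FD.meet (S ∪ T) hu = FD.meet S hS ⊓ FD.meet T hT :=
      Finset.inf'_union hS hT _
    have := h _ hu (hST ▸ inf_le_inf hle hle')
    rwa [hST, inf_comm (FD.meet S hS), inf_assoc] at this

theorem FD.le_of_forall_meet {r : ℕ} {x y : FD r}
    (h : ∀ (S : Finset (Fin r)) (hS : S.Nonempty), FD.meet S hS ≤ x → FD.meet S hS ≤ y) :
    x ≤ y := by
  have := FD.inf_le_of_forall_meet x x y fun S hS hle => inf_le_left.trans (h S hS hle)
  rwa [inf_idem] at this

instance {r : ℕ} : Finite (FD r) := by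
  refine Finite.of_injective (FD.toSets r) fun x y h => le_antisymm ?_ ?_ <;>
  · refine FD.le_of_forall_meet fun S hS => ?_
    rw [FD.meet_le_iff, FD.meet_le_iff, h]
    exact id

theorem existsUnique_covBy_of_forall_lt {L : Type*} [PartialOrder L] {x y : L} (hy : y < x)
    (h : ∀ z, z < x → z ≤ y) : ∃! y, y ⋖ x := by
  refine ⟨y, ⟨hy, fun z hz hzx => (h z hzx).not_gt hz⟩, fun z hz => ?_⟩
  exact (h z hz.lt).eq_or_lt.resolve_right fun hlt => hz.2 hlt hy

/-- The lower cover is the join of the meets over `insert i S` with `i ∉ S`. It dominates everything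
strictly below `FD.meet S hS`, because a meet over `T` strictly below has `T` properly containing
`S`. -/
theorem FD.existsUnique_covBy_meet {r : ℕ} {S : Finset (Fin r)} (hS : S.Nonempty)
    (hS' : Sᶜ.Nonempty) : ∃! y, y ⋖ FD.meet S hS := by
  let m : Fin r → FD r := fun i => FD.meet (insert i S) (Finset.insert_nonempty i S)
  have hle : Sᶜ.sup' hS' m ≤ FD.meet S hS :=
    Finset.sup'_le _ _ fun i _ => (FD.meet_le_meet_iff _ _).2 (Finset.subset_insert i S)
  refine existsUnique_covBy_of_forall_lt (lt_of_le_not_ge hle ?_) fun z hz => ?_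
  · rw [FD.meet_le_iff, map_finset_sup']
    suffices ∀ i ∈ Sᶜ, S ∉ FD.toSets r (m i) by
      rw [Finset.sup'_eq_sup, Finset.sup_set_eq_biUnion]
      simpa using this
    intro i hi h
    exact Finset.mem_compl.1 hi ((FD.mem_toSets_meet _).1 h (Finset.mem_insert_self i S))
  · refine FD.le_of_forall_meet fun T hT hTz => ?_
    have hST : S ⊆ T := (FD.meet_le_meet_iff _ _).1 (hTz.trans hz.le)
    have hne : ¬ T ⊆ S := fun h => hz.not_ge (((FD.meet_le_meet_iff hS hT).2 h).trans hTz)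
    obtain ⟨i, hi, hi'⟩ := Finset.not_subset.1 hne
    exact ((FD.meet_le_meet_iff hT _).2 (Finset.insert_subset hi hST)).trans
      (Finset.le_sup' m (Finset.mem_compl.2 hi'))

theorem FD.meet_univ_le {r : ℕ} (h : (Finset.univ : Finset (Fin r)).Nonempty) (x : FD r) :
    FD.meet Finset.univ h ≤ x := by
  induction x using FD.induction_on with
  | gen i => exact Finset.inf'_le _ (Finset.mem_univ i)
  | sup x y hx hy => exact hx.trans le_sup_left
  | inf x y hx hy => exact le_inf hx hy

/-- Otherwise every meet of generators below `x` is strictly below it, hence below the only lower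
cover `y`; as `x` is determined by these meets, `x ≤ y`. The full set of generators is excluded
because its meet is the bottom, which covers nothing. -/
theorem FD.exists_eq_meet {r : ℕ} {x : FD r} (hx : ∃! y, y ⋖ x) :
    ∃ (S : Finset (Fin r)) (hS : S.Nonempty), Sᶜ.Nonempty ∧ x = FD.meet S hS := by
  obtain ⟨y, hy, huniq⟩ := hx
  by_contra! hcon
  have key : ∀ (S : Finset (Fin r)) (hS : S.Nonempty), FD.meet S hS ≤ x →
      FD.meet S hS ≠ x := by
    rintro S hS hle rfl
    refine hcon S hS ?_ rfl
    rw [Finset.nonempty_iff_ne_empty, Ne, Finset.compl_eq_empty_iff]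
    rintro rfl
    exact hy.lt.not_ge (FD.meet_univ_le hS y)
  refine hy.lt.not_ge (FD.le_of_forall_meet fun S hS hle => ?_)
  obtain ⟨z, hz, hzx⟩ := exists_le_covBy_of_lt (lt_of_le_of_ne hle (key S hS hle))
  exact huniq z hzx ▸ hz

theorem nonempty_compl_of_mem_FSP {r : ℕ} (X : FSP r 0 r) : (X.1ᶜ).Nonempty := by
  rw [← Finset.card_pos, Finset.card_compl, Fintype.card_fin]
  have := X.2.2
  omega

/-- The join-irreducible elements of `FD r` are the meets of the nonempty proper sets of
generators. -/
theorem nonempty_FSP_orderIso_Jir (r : ℕ) : Nonempty (FSP r 0 r ≃o Jir (FD r)) := by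
  let f : FSP r 0 r ↪o Jir (FD r) := OrderEmbedding.ofMapLEIff
    (fun X => ⟨FD.meet X.1ᶜ (nonempty_compl_of_mem_FSP X),
      FD.existsUnique_covBy_meet _ (by simpa using Finset.card_pos.1 X.2.1)⟩) (fun X Y => by
        rw [Subtype.mk_le_mk, FD.meet_le_meet_iff]
        exact Finset.compl_subset_compl)
  refine ⟨RelIso.ofSurjective f ?_⟩
  rintro ⟨x, hx⟩
  obtain ⟨S, hS, hS', rfl⟩ := FD.exists_eq_meet hx
  refine ⟨⟨Sᶜ, Finset.card_pos.2 hS', ?_⟩, Subtype.ext ?_⟩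
  · have := Finset.card_pos.2 hS
    have := Finset.card_compl_add_card S
    rw [Fintype.card_fin] at this
    omega
  · change FD.meet Sᶜᶜ (by simpa using hS) = _
    congr 1
    exact compl_compl S

theorem Sp_congr {U V : Type*} [PartialOrder U] [PartialOrder V] (e : U ≃o V) (n : ℕ) :
    Sp U n = Sp V n := by
  have h : ∀ C : Finset (Finset (Fin n)), IsCopy U C ↔ IsCopy V C := fun C =>
    ⟨fun ⟨f⟩ => ⟨e.symm.trans f⟩, fun ⟨f⟩ => ⟨e.trans f⟩⟩
  simp only [Sp, copyNumbers, h]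

theorem Sp_FSP_eq_Sp_Jir (r n : ℕ) : Sp (FSP r 0 r) n = Sp (Jir (FD r)) n :=
  Sp_congr (nonempty_FSP_orderIso_Jir r).some n

end SpernerFD

namespace SpernerFD

/-! ### The lower estimates -/

/-- Non-inclusion in one direction suffices, since `a` and `b` may be swapped. A nonempty `U`
ensures that distinct indices give distinct copies. -/
theorem card_le_Sp {U ι : Type*} [PartialOrder U] [Fintype U] [Nonempty U] {n : ℕ} (s : Finset ι)
    (f : ι → U → Finset (Fin n)) (hle : ∀ a ∈ s, ∀ X Y, f a X ⊆ f a Y ↔ X ≤ Y)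
    (hunrel : ∀ a ∈ s, ∀ b ∈ s, a ≠ b → ∀ X Y, ¬ f a X ⊆ f b Y) : s.card ≤ Sp U n := by
  classical
  refine (isGreatest_Sp U n).2
    ⟨s.image fun a => Finset.univ.image (f a), Finset.card_image_of_injOn ?_, ?_, ?_⟩
  · intro a ha b hb hab
    by_contra hne
    obtain ⟨X⟩ := ‹Nonempty U›
    have hX : f a X ∈ Finset.univ.image (f b) := by
      rw [← show Finset.univ.image (f a) = Finset.univ.image (f b) from hab]
      exact Finset.mem_image_of_mem _ (Finset.mem_univ X)
    obtain ⟨Y, -, hY⟩ := Finset.mem_image.1 hX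
    exact hunrel a ha b hb hne X Y hY.ge
  · intro C hC
    obtain ⟨a, ha, rfl⟩ := Finset.mem_image.1 hC
    let g : U ↪o {X : Finset (Fin n) // X ∈ Finset.univ.image (f a)} :=
      OrderEmbedding.ofMapLEIff
        (fun X => ⟨f a X, Finset.mem_image_of_mem _ (Finset.mem_univ X)⟩) (hle a ha)
    refine ⟨RelIso.ofSurjective g ?_⟩
    rintro ⟨Z, hZ⟩
    obtain ⟨X, -, rfl⟩ := Finset.mem_image.1 hZ
    exact ⟨X, rfl⟩
  · intro C hC D hD hne Z hZ W hW
    obtain ⟨a, ha, rfl⟩ := Finset.mem_image.1 hC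
    obtain ⟨b, hb, rfl⟩ := Finset.mem_image.1 hD
    obtain ⟨X, -, rfl⟩ := Finset.mem_image.1 hZ
    obtain ⟨Y, -, rfl⟩ := Finset.mem_image.1 hW
    have hab : a ≠ b := fun h => hne (h ▸ rfl)
    exact ⟨hunrel a ha b hb hab X Y, hunrel b hb a ha hab.symm Y X⟩

/-- The `i`-th of the consecutive blocks of length `r` of `Fin n`. -/
def blockEmb (r n : ℕ) (i : Fin (n / r)) : Fin r ↪ Fin n where
  toFun y := ⟨i * r + y, by
    calc (i * r + y : ℕ) < (i + 1) * r := by rw [add_one_mul]; exact Nat.add_lt_add_left y.2 _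
      _ ≤ n / r * r := Nat.mul_le_mul_right r i.2
      _ ≤ n := Nat.div_mul_le_self n r⟩
  inj' y z h := by simpa [Fin.ext_iff] using h

variable {r n : ℕ}

theorem blockEmb_div {i : Fin (n / r)} (y : Fin r) : (blockEmb r n i y : ℕ) / r = i := by
  change (i * r + y : ℕ) / r = i
  rw [mul_comm, Nat.mul_add_div y.pos, Nat.div_eq_of_lt y.2, add_zero]

/-- The part beyond the `i`-th block. -/
def afterBlock (r n : ℕ) (i : Fin (n / r)) : Finset (Fin n) :=
  {x | (i + 1) * r ≤ (x : ℕ)}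

theorem card_afterBlock (i : Fin (n / r)) : (afterBlock r n i).card = n - (i + 1) * r := by
  have h := Finset.card_filter_add_card_filter_not (s := (Finset.univ : Finset (Fin n)))
    fun x => (x : ℕ) < (i + 1) * r
  simp only [not_lt, Fin.card_filter_val_lt, Finset.card_univ, Fintype.card_fin] at h
  rw [afterBlock]
  omega

theorem blockEmb_mem_afterBlock {i j : Fin (n / r)} {y : Fin r} :
    blockEmb r n j y ∈ afterBlock r n i ↔ i < j := by
  rw [afterBlock, Finset.mem_filter_univ, ← Nat.le_div_iff_mul_le y.pos, blockEmb_div,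
    Nat.add_one_le_iff, Fin.lt_def]

/-- The common lower part of the members of a copy. -/
def copyBase (J : Finset (Fin (n / r))) (R : Finset (Fin n)) : Finset (Fin n) :=
  R ∪ J.biUnion fun j => Finset.univ.map (blockEmb r n j)

theorem blockEmb_mem_copyBase {i j : Fin (n / r)} {J : Finset (Fin (n / r))}
    {R : Finset (Fin n)} (hR : R ⊆ afterBlock r n i) (hj : j ≤ i) {y : Fin r} :
    blockEmb r n j y ∈ copyBase J R ↔ j ∈ J := by
  have hyR : blockEmb r n j y ∉ R := fun h => hj.not_gt (blockEmb_mem_afterBlock.1 (hR h))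
  simp only [copyBase, Finset.mem_union, hyR, false_or, Finset.mem_biUnion, Finset.mem_map,
    Finset.mem_univ, true_and]
  constructor
  · rintro ⟨k, hk, z, hz⟩
    have := congrArg (fun x : Fin n => (x : ℕ) / r) hz
    simp only [blockEmb_div] at this
    rwa [← Fin.ext this]
  · exact fun h => ⟨j, h, y, rfl⟩

theorem card_copyBase {i : Fin (n / r)} {J : Finset (Fin (n / r))} {R : Finset (Fin n)}
    (hJ : J ⊆ Finset.Iio i) (hR : R ⊆ afterBlock r n i) :
    (copyBase J R).card = R.card + J.card * r := by
  rw [copyBase, Finset.card_union_of_disjoint, Finset.card_biUnion]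
  · simp
  · intro j _ k _ hjk
    refine Finset.disjoint_left.2 ?_
    simp only [Finset.mem_map, Finset.mem_univ, true_and]
    rintro _ ⟨y, rfl⟩ ⟨z, hz⟩
    have := congrArg (fun x : Fin n => (x : ℕ) / r) hz
    simp only [blockEmb_div] at this
    exact hjk (Fin.ext this.symm)
  · rw [Finset.disjoint_left]
    simp only [Finset.mem_biUnion, Finset.mem_map, Finset.mem_univ, true_and]
    rintro _ h ⟨j, hj, y, rfl⟩
    exact (Finset.mem_Iio.1 (hJ hj)).not_gt (blockEmb_mem_afterBlock.1 (hR h))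

/-- `J` is read off from the first points of the blocks up to `i`, and `R` by intersecting with the
part after block `i`. -/
theorem copyBase_injective {i : Fin (n / r)} {J J' : Finset (Fin (n / r))}
    {R R' : Finset (Fin n)} (hr : 0 < r) (hJ : J ⊆ Finset.Iio i) (hJ' : J' ⊆ Finset.Iio i)
    (hR : R ⊆ afterBlock r n i) (hR' : R' ⊆ afterBlock r n i)
    (h : copyBase J R = copyBase J' R') : J = J' ∧ R = R' := by
  constructor
  · ext j
    by_cases hj : j ≤ i
    · rw [← blockEmb_mem_copyBase hR hj (y := ⟨0, hr⟩), h, blockEmb_mem_copyBase hR' hj]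
    · exact iff_of_false (fun hm => hj (Finset.mem_Iio.1 (hJ hm)).le)
        (fun hm => hj (Finset.mem_Iio.1 (hJ' hm)).le)
  · have key : ∀ {J : Finset (Fin (n / r))} {R : Finset (Fin n)}, J ⊆ Finset.Iio i →
        R ⊆ afterBlock r n i → copyBase J R ∩ afterBlock r n i = R := by
      intro J R hJ hR
      ext x
      simp only [copyBase, Finset.mem_inter, Finset.mem_union, Finset.mem_biUnion,
        Finset.mem_map, Finset.mem_univ, true_and]
      constructor
      · rintro ⟨h | ⟨j, hj, y, rfl⟩, hx⟩
        · exact h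
        · exact absurd (blockEmb_mem_afterBlock.1 hx) (Finset.mem_Iio.1 (hJ hj)).not_gt
      · exact fun h => ⟨.inl h, hR h⟩
    rw [← key hJ hR, h, key hJ' hR']

/-- Look at the earlier of the blocks `i`, `i'`: one of the two sets meets it in a free part, while
the other contains all or none of it. Equal base sizes then rule out an inclusion. -/
theorem copyMember_unrelated {i i' : Fin (n / r)} {J J' : Finset (Fin (n / r))}
    {R R' : Finset (Fin n)} (hJ : J ⊆ Finset.Iio i) (hJ' : J' ⊆ Finset.Iio i')
    (hR : R ⊆ afterBlock r n i) (hR' : R' ⊆ afterBlock r n i')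
    (hcard : (copyBase J R).card = (copyBase J' R').card) {X Y : Finset (Fin r)}
    (hX : 0 < X.card) (hY : Y.card < r)
    (h : copyBase J R ∪ X.map (blockEmb r n i) ⊆ copyBase J' R' ∪ Y.map (blockEmb r n i')) :
    i = i' ∧ J = J' ∧ R = R' := by
  have hne : ∀ {k l : Fin (n / r)} {y : Fin r} {Z : Finset (Fin r)}, k ≠ l →
      blockEmb r n k y ∉ Z.map (blockEmb r n l) := by
    intro k l y Z hkl hm
    obtain ⟨z, -, hz⟩ := Finset.mem_map.1 hm
    have := congrArg (fun x : Fin n => (x : ℕ) / r) hz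
    simp only [blockEmb_div] at this
    exact hkl (Fin.ext this.symm)
  obtain ⟨x, hx⟩ := Finset.card_pos.1 hX
  rcases lt_trichotomy i i' with hi | rfl | hi
  -- Block `i` must lie wholly in the right-hand base, whereas the left-hand base avoids it. So that
  -- base fits into `c - r` points together with fewer than `r` points of `Y`, where `c` is the
  -- common base size.
  · have hiJ : i ∈ J' := by
      have := h (Finset.mem_union_right _ (Finset.mem_map_of_mem _ hx))
      rw [Finset.mem_union, or_iff_left (hne hi.ne)] at this
      rwa [blockEmb_mem_copyBase hR' hi.le] at this
    have hsub : Finset.univ.map (blockEmb r n i) ⊆ copyBase J' R' := by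
      intro z hz
      obtain ⟨y, -, rfl⟩ := Finset.mem_map.1 hz
      exact (blockEmb_mem_copyBase hR' hi.le).2 hiJ
    have hsub' : copyBase J R ⊆
        (copyBase J' R' \ Finset.univ.map (blockEmb r n i)) ∪ Y.map (blockEmb r n i') := by
      intro z hz
      have hz' := h (Finset.mem_union_left _ hz)
      rw [Finset.mem_union] at hz' ⊢
      refine hz'.imp_left fun hz'' => Finset.mem_sdiff.2 ⟨hz'', fun hm => ?_⟩
      obtain ⟨y, -, rfl⟩ := Finset.mem_map.1 hm
      rw [blockEmb_mem_copyBase hR le_rfl] at hz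
      exact lt_irrefl _ (Finset.mem_Iio.1 (hJ hz))
    have h1 := (Finset.card_le_card hsub').trans (Finset.card_union_le _ _)
    have h2 := Finset.card_le_card hsub
    rw [Finset.card_sdiff_of_subset hsub] at h1
    rw [Finset.card_map] at h1 h2
    simp only [Finset.card_map, Finset.card_univ, Fintype.card_fin] at h1 h2
    omega
  · have hsub : copyBase J R ⊆ copyBase J' R' := by
      intro z hz
      refine (Finset.mem_union.1 (h (Finset.mem_union_left _ hz))).resolve_right fun hm => ?_
      obtain ⟨y, -, rfl⟩ := Finset.mem_map.1 hm
      rw [blockEmb_mem_copyBase hR le_rfl] at hz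
      exact lt_irrefl _ (Finset.mem_Iio.1 (hJ hz))
    exact ⟨rfl, copyBase_injective x.pos hJ hJ' hR hR'
      (Finset.eq_of_subset_of_card_le hsub hcard.ge)⟩
  · exfalso
    -- As `Y` is proper, block `i'` cannot be full on the left, so it is empty there. The left-hand
    -- set then lies in the right-hand base, which is too small since `X` is nonempty.
    have hiJ : i' ∉ J := by
      intro hm
      have hall : ∀ y : Fin r, y ∈ Y := by
        intro y
        have := h (Finset.mem_union_left _ ((blockEmb_mem_copyBase hR hi.le (y := y)).2 hm))
        rw [Finset.mem_union, blockEmb_mem_copyBase hR' le_rfl, Finset.mem_map'] at this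
        exact this.resolve_left fun h => lt_irrefl _ (Finset.mem_Iio.1 (hJ' h))
      rw [Finset.eq_univ_of_forall hall, Finset.card_univ, Fintype.card_fin] at hY
      exact lt_irrefl _ hY
    have hsub : copyBase J R ∪ X.map (blockEmb r n i) ⊆ copyBase J' R' := by
      intro z hz
      refine (Finset.mem_union.1 (h hz)).resolve_right fun hm => ?_
      obtain ⟨y, -, rfl⟩ := Finset.mem_map.1 hm
      rw [Finset.mem_union, blockEmb_mem_copyBase hR hi.le, or_iff_right hiJ] at hz
      exact hne hi.ne hz
    have hdisj : Disjoint (copyBase J R) (X.map (blockEmb r n i)) := by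
      rw [Finset.disjoint_right]
      intro z hz hz'
      obtain ⟨y, -, rfl⟩ := Finset.mem_map.1 hz
      rw [blockEmb_mem_copyBase hR le_rfl] at hz'
      exact lt_irrefl _ (Finset.mem_Iio.1 (hJ hz'))
    have := Finset.card_le_card hsub
    rw [Finset.card_union_of_disjoint hdisj, Finset.card_map] at this
    omega

theorem card_filter_powerset_eq_binom {α : Type*} (T : Finset α) (z : ℤ) :
    (T.powerset.filter fun R => (R.card : ℤ) = z).card = binom T.card z := by
  rw [binom]
  split_ifs with h
  · lift z to ℕ using h.1
    rw [Int.toNat_natCast, Int.toNat_natCast, ← Finset.card_powersetCard]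
    congr 1
    ext R
    simp [Finset.mem_powersetCard]
  · rw [Finset.card_eq_zero, Finset.filter_eq_empty_iff]
    rintro R hR rfl
    have := Finset.card_le_card (Finset.mem_powerset.1 hR)
    omega

/-- Indices `⟨i, (J, R)⟩` of pairwise unrelated copies. -/
def copyIndices (r n : ℕ) (c : ℤ) :
    Finset (Σ _ : Fin (n / r), Σ _ : Finset (Fin (n / r)), Finset (Fin n)) :=
  Finset.univ.sigma fun i => (Finset.Iio i).powerset.sigma fun J =>
    (afterBlock r n i).powerset.filter fun R => (R.card : ℤ) = c - J.card * r

/-- In the double sum `i` is the block of the copy, `j` is the size of `J`, and the two binomials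
count the choices of `J` and of `R`. -/
theorem card_copyIndices (p : ℤ) (r n : ℕ) :
    (copyIndices r n (p + ((n : ℤ) - r) / 2)).card = fLower p r n := by
  rw [copyIndices, Finset.card_sigma, fLower, ← Fin.sum_univ_eq_sum_range
    (fun i => ∑ j ∈ Finset.range (i + 1),
      i.choose j * binom ((n : ℤ) - (i + 1) * r) (p + ((n : ℤ) - r) / 2 - j * r))]
  refine Finset.sum_congr rfl fun i _ => ?_
  have hi : (i + 1) * r ≤ n :=
    (Nat.mul_le_mul_right r i.2).trans (Nat.div_mul_le_self n r)
  rw [Finset.card_sigma]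
  simp only [card_filter_powerset_eq_binom, card_afterBlock]
  rw [Finset.sum_powerset_apply_card
    (fun m => binom ((n - (i + 1) * r : ℕ) : ℤ) (p + ((n : ℤ) - r) / 2 - m * r)), Fin.card_Iio]
  push_cast [Nat.cast_sub hi]
  simp only [smul_eq_mul]

theorem fLower_le_Sp_FSP (p : ℤ) (hr : 2 ≤ r) (n : ℕ) : fLower p r n ≤ Sp (FSP r 0 r) n := by
  have : Nonempty (FSP r 0 r) := ⟨⟨{⟨0, by omega⟩}, by simp, by simp; omega⟩⟩
  rw [← card_copyIndices]
  have hmem : ∀ a ∈ copyIndices r n (p + ((n : ℤ) - r) / 2), a.2.1 ⊆ Finset.Iio a.1 ∧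
      a.2.2 ⊆ afterBlock r n a.1 ∧
      ((copyBase a.2.1 a.2.2).card : ℤ) = p + ((n : ℤ) - r) / 2 := by
    intro a ha
    simp only [copyIndices, Finset.mem_sigma, Finset.mem_univ, true_and, Finset.mem_powerset,
      Finset.mem_filter] at ha
    refine ⟨ha.1, ha.2.1, ?_⟩
    rw [card_copyBase ha.1 ha.2.1]
    push_cast
    rw [ha.2.2]
    ring
  refine card_le_Sp _ (fun a X => copyBase a.2.1 a.2.2 ∪ X.1.map (blockEmb r n a.1)) ?_ ?_
  · intro a ha X Y
    obtain ⟨hJ, hR, -⟩ := hmem a ha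
    constructor
    · intro h x hx
      have := h (Finset.mem_union_right _ (Finset.mem_map_of_mem _ hx))
      rw [Finset.mem_union, blockEmb_mem_copyBase hR le_rfl, Finset.mem_map'] at this
      exact this.resolve_left fun h => lt_irrefl _ (Finset.mem_Iio.1 (hJ h))
    · exact fun h => Finset.union_subset_union_right (Finset.map_subset_map.2 h)
  · intro a ha b hb hne X Y h
    obtain ⟨hJ, hR, hc⟩ := hmem a ha
    obtain ⟨hJ', hR', hc'⟩ := hmem b hb
    obtain ⟨h1, h2, h3⟩ := copyMember_unrelated hJ hJ' hR hR'
      (by exact_mod_cast hc.trans hc'.symm) X.2.1 Y.2.2 h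
    obtain ⟨i, J, R⟩ := a
    obtain ⟨i', J', R'⟩ := b
    dsimp only at h1 h2 h3
    subst h1 h2 h3
    exact hne rfl

end SpernerFD

namespace SpernerFD

/-! ### Bollobás' inequality for set pairs and the upper estimates -/

theorem mul_inv_choose_pred {a c : ℕ} (hc : 0 < c) :
    (c : ℚ) * ((a + (c - 1)).choose a : ℚ)⁻¹ = (a + c) * ((a + c).choose a : ℚ)⁻¹ := by
  obtain ⟨c, rfl⟩ := Nat.exists_eq_succ_of_ne_zero hc.ne'
  have h := Nat.choose_mul_succ_eq (a + c) a
  rw [show a + c + 1 - a = c + 1 by omega] at h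
  have h1 : ((a + c).choose a : ℚ) ≠ 0 := by
    exact_mod_cast (Nat.choose_pos (Nat.le_add_right a c)).ne'
  have h2 : ((a + (c + 1)).choose a : ℚ) ≠ 0 := by
    exact_mod_cast (Nat.choose_pos (Nat.le_add_right a (c + 1))).ne'
  have h' : ((a + c).choose a : ℚ) * (a + c + 1) = ((a + (c + 1)).choose a : ℚ) * (c + 1) := by
    exact_mod_cast h
  rw [Nat.succ_eq_add_one, Nat.add_sub_cancel]
  field_simp
  push_cast
  linear_combination -h'

/-- **Bollobás' set pairs inequality**. -/
theorem sum_inv_choose_le_one {α ι : Type*} [DecidableEq α] (X : Finset α) (s : Finset ι)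
    (A C : ι → Finset α) (hA : ∀ i ∈ s, A i ⊆ X) (hC : ∀ i ∈ s, C i ⊆ X)
    (hdisj : ∀ i ∈ s, Disjoint (A i) (C i))
    (hcross : ∀ i ∈ s, ∀ j ∈ s, i ≠ j → ¬ Disjoint (A i) (C j)) :
    ∑ i ∈ s, (((A i).card + (C i).card).choose (A i).card : ℚ)⁻¹ ≤ 1 := by
  classical
  induction hN : X.card generalizing X s C with
  | zero =>
    have hX : X = ∅ := Finset.card_eq_zero.1 hN
    have hs : s.card ≤ 1 := by
      refine Finset.card_le_one.2 fun i hi j hj => by_contra fun hne => hcross i hi j hj hne ?_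
      have hAi := hA i hi
      rw [hX, Finset.subset_empty] at hAi
      rw [hAi]
      exact Finset.disjoint_empty_left _
    calc _ ≤ ∑ i ∈ s, (1 : ℚ) := Finset.sum_le_sum fun i hi => by
          have hAi := hA i hi
          rw [hX, Finset.subset_empty] at hAi
          simp [hAi]
      _ ≤ 1 := by simpa using hs
  | succ N ih =>
    by_cases hempty : ∃ i ∈ s, C i = ∅
    · obtain ⟨i, hi, hCi⟩ := hempty
      have hs : s = {i} := by
        refine Finset.eq_singleton_iff_unique_mem.2 ⟨hi, fun j hj => by_contra fun hne => ?_⟩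
        exact hcross j hj i hi hne (hCi ▸ Finset.disjoint_empty_right _)
      simp [hs, hCi]
    · push Not at hempty
      -- Induction by averaging over `x`: keep the pairs with `x ∉ A i` and delete `x` from `C i`. A
      -- common point of `A i` and `C j` survives, since it is not `x`.
      have hx : ∀ x ∈ X, ∑ i ∈ s with x ∉ A i,
          (((A i).card + ((C i).erase x).card).choose (A i).card : ℚ)⁻¹ ≤ 1 := by
        intro x hx
        refine ih (X.erase x) {i ∈ s | x ∉ A i} (fun i => (C i).erase x) ?_ ?_ ?_ ?_ ?_
        · intro i hi
          obtain ⟨hi, hxi⟩ := Finset.mem_filter.1 hi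
          exact Finset.subset_erase.2 ⟨hA i hi, hxi⟩
        · exact fun i hi => Finset.erase_subset_erase x (hC i (Finset.mem_filter.1 hi).1)
        · exact fun i hi => (hdisj i (Finset.mem_filter.1 hi).1).mono_right
            (Finset.erase_subset x _)
        · intro i hi j hj hne hd
          obtain ⟨hi, hxi⟩ := Finset.mem_filter.1 hi
          refine hcross i hi j (Finset.mem_filter.1 hj).1 hne (Finset.disjoint_left.2 ?_)
          intro y hy hy'
          refine Finset.disjoint_left.1 hd hy (Finset.mem_erase.2 ⟨?_, hy'⟩)
          rintro rfl
          exact hxi hy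
        · rw [Finset.card_erase_of_mem hx, hN, Nat.add_sub_cancel]
      have hsum := Finset.sum_le_sum hx
      simp only [Finset.sum_filter] at hsum
      rw [Finset.sum_comm] at hsum
      -- With a = |A i|, c = |C i| and weight w, the N+1-a-c points outside both sets contribute w
      -- each, and the points of `C i` contribute (a+c)w altogether, by `mul_inv_choose_pred`.
      have hi : ∀ i ∈ s, ∑ x ∈ X, (if x ∉ A i then
          (((A i).card + ((C i).erase x).card).choose (A i).card : ℚ)⁻¹ else 0) =
          (N + 1) * (((A i).card + (C i).card).choose (A i).card : ℚ)⁻¹ := by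
        intro i hi
        have hCX : C i ⊆ X \ A i :=
          Finset.subset_sdiff.2 ⟨hC i hi, (hdisj i hi).symm⟩
        rw [← Finset.sum_filter, ← Finset.sdiff_eq_filter, ← Finset.sum_sdiff hCX]
        have h1 : ∀ x ∈ (X \ A i) \ C i,
            (((A i).card + ((C i).erase x).card).choose (A i).card : ℚ)⁻¹ =
            (((A i).card + (C i).card).choose (A i).card : ℚ)⁻¹ := by
          intro x hx
          rw [Finset.erase_eq_of_notMem (Finset.mem_sdiff.1 hx).2]
        have h2 : ∀ x ∈ C i,
            (((A i).card + ((C i).erase x).card).choose (A i).card : ℚ)⁻¹ =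
            (((A i).card + ((C i).card - 1)).choose (A i).card : ℚ)⁻¹ := by
          intro x hx
          rw [Finset.card_erase_of_mem hx]
        rw [Finset.sum_congr rfl h1, Finset.sum_congr rfl h2, Finset.sum_const, Finset.sum_const,
          nsmul_eq_mul, nsmul_eq_mul, mul_inv_choose_pred (Finset.card_pos.2 (hempty i hi)),
          ← add_mul]
        congr 1
        have hc1 := Finset.card_sdiff_add_card_eq_card hCX
        have hc2 := Finset.card_sdiff_add_card_eq_card (hA i hi)
        rw [hN] at hc2
        rw [← hc1] at hc2
        have hc3 : ((((X \ A i) \ C i).card : ℚ) + (C i).card + (A i).card) = N + 1 := by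
          exact_mod_cast hc2
        linear_combination hc3
      rw [Finset.sum_congr rfl hi, ← Finset.mul_sum, Finset.sum_const, nsmul_eq_mul, hN] at hsum
      push_cast at hsum
      exact le_of_mul_le_mul_left hsum (by positivity)

theorem card_le_choose_of_set_pairs {α ι : Type*} [DecidableEq α] [Fintype α] (s : Finset ι)
    (A C : ι → Finset α) {m : ℕ} (hm : ∀ i ∈ s, (A i).card + (C i).card ≤ m)
    (hdisj : ∀ i ∈ s, Disjoint (A i) (C i))
    (hcross : ∀ i ∈ s, ∀ j ∈ s, i ≠ j → ¬ Disjoint (A i) (C j)) :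
    s.card ≤ m.choose (m / 2) := by
  have h := sum_inv_choose_le_one Finset.univ s A C (fun _ _ => Finset.subset_univ _)
    (fun _ _ => Finset.subset_univ _) hdisj hcross
  have hpos : (0 : ℚ) < m.choose (m / 2) := by
    exact_mod_cast Nat.choose_pos (Nat.div_le_self m 2)
  have hle : ∑ i ∈ s, ((m.choose (m / 2) : ℚ))⁻¹ ≤ 1 := by
    refine (Finset.sum_le_sum fun i hi => ?_).trans h
    refine inv_anti₀ (by exact_mod_cast Nat.choose_pos (Nat.le_add_right _ _)) ?_
    exact_mod_cast (Nat.choose_le_choose _ (hm i hi)).trans (Nat.choose_le_middle _ m)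
  rw [Finset.sum_const, nsmul_eq_mul, ← div_eq_mul_inv, div_le_one hpos] at hle
  exact_mod_cast hle

/-- A maximum family of pairwise unrelated copies. -/
theorem exists_unrelated_copies (U : Type*) [PartialOrder U] (n : ℕ) :
    ∃ f : Fin (Sp U n) → U → Finset (Fin n), (∀ a X Y, f a X ⊆ f a Y ↔ X ≤ Y) ∧
      ∀ a b, a ≠ b → ∀ X Y, ¬ f a X ⊆ f b Y := by
  obtain ⟨𝒞, hcard, hcopy, hunrel⟩ := (isGreatest_Sp U n).1
  let e := (Fintype.equivFinOfCardEq (α := 𝒞) (by simpa using hcard)).symm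
  let g a : U ≃o {X : Finset (Fin n) // X ∈ (e a).1} := (hcopy (e a).1 (e a).2).some
  refine ⟨fun a X => (g a X).1, fun a X Y => (g a).le_iff_le, fun a b hne X Y => ?_⟩
  exact (hunrel _ (e a).2 _ (e b).2 (fun h => hne (e.injective (Subtype.ext h))) _ (g a X).2 _
    (g b Y).2).1

/-- Along a maximal chain from `X` to `Y` the images grow by at least one point per step. -/
theorem card_add_card_le_of_embedding {r n : ℕ} {f : FSP r 0 r → Finset (Fin n)}
    (hf : ∀ X Y, f X ⊆ f Y ↔ X ≤ Y) {X Y : FSP r 0 r} (h : X ≤ Y) :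
    (f X).card + Y.1.card ≤ (f Y).card + X.1.card := by
  induction hk : Y.1.card - X.1.card generalizing Y with
  | zero =>
    have hXY : X = Y := Subtype.ext (Finset.eq_of_subset_of_card_le h (by omega))
    rw [hXY]
  | succ k ih =>
    obtain ⟨Z, hXZ, hZY, hZ⟩ := Finset.exists_subsuperset_card_eq h
      (n := Y.1.card - 1) (by omega) (by omega)
    let Z' : FSP r 0 r := ⟨Z, by have := X.2.1; omega, by have := Y.2.2; omega⟩
    have h1 := ih (Y := Z') hXZ (by change Z.card - _ = _; omega)
    have h2 : (f Z').card < (f Y).card := by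
      refine Finset.card_lt_card ⟨(hf _ _).2 hZY, fun hle => ?_⟩
      have h3 : Y.1.card ≤ Z.card := Finset.card_le_card ((hf Y Z').1 hle)
      omega
    change _ + Z.card ≤ _ at h1
    omega

theorem Sp_FSP_le_gUpper {r : ℕ} (hr : 3 ≤ r) {n : ℕ} (hn : r ≤ n) :
    Sp (FSP r 0 r) n ≤ gUpper r n := by
  obtain ⟨f, hf, hunrel⟩ := exists_unrelated_copies (FSP r 0 r) n
  let v : Bool → Fin r := fun b => if b then ⟨0, by omega⟩ else ⟨1, by omega⟩
  have hv : ∀ b b', v b = v b' → b = b' := by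
    intro b b' h
    cases b <;> cases b' <;> simp [v] at h ⊢
  let lo : Bool → FSP r 0 r := fun b => ⟨{v b}, by simp, by simp; omega⟩
  have hcompl : ∀ b, ({v b}ᶜ : Finset (Fin r)).card = r - 1 := by
    intro b
    rw [Finset.card_compl, Finset.card_singleton, Fintype.card_fin]
  -- Omitting the opposite atom makes `lo b ≤ hi b'` equivalent to `b = b'`, so the two intervals of
  -- one copy also satisfy the cross condition.
  let hi : Bool → FSP r 0 r := fun b => ⟨{v !b}ᶜ, by rw [hcompl]; omega, by rw [hcompl]; omega⟩
  have hlohi : ∀ b b', lo b ≤ hi b' ↔ b = b' := by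
    intro b b'
    change {v b} ⊆ ({v !b'}ᶜ : Finset (Fin r)) ↔ _
    rw [Finset.singleton_subset_iff, Finset.mem_compl, Finset.mem_singleton]
    constructor
    · intro h
      by_contra hne
      exact h (congrArg v (Bool.eq_not_of_ne hne))
    · rintro rfl h
      exact absurd (hv _ _ h) (by cases b <;> decide)
  -- Each interval spans at least `r - 2` points, so a set pair uses at most `n + 2 - r` of them.
  have key := card_le_choose_of_set_pairs (Finset.univ : Finset (Fin (Sp (FSP r 0 r) n) × Bool))
    (fun i => f i.1 (lo i.2)) (fun i => (f i.1 (hi i.2))ᶜ) (m := n + 2 - r) ?_ ?_ ?_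
  · rw [Finset.card_univ, Fintype.card_prod, Fintype.card_fin, Fintype.card_bool] at key
    rw [gUpper, fsp]
    omega
  · rintro ⟨a, b⟩ -
    have h := card_add_card_le_of_embedding (hf a) ((hlohi b b).2 rfl)
    have h1 : (lo b).1.card = 1 := Finset.card_singleton _
    have h2 : (hi b).1.card = r - 1 := hcompl _
    have h3 := Finset.card_le_univ (f a (hi b))
    rw [Fintype.card_fin] at h3
    dsimp only
    rw [Finset.card_compl, Fintype.card_fin]
    omega
  · rintro ⟨a, b⟩ -
    exact disjoint_compl_right_iff.2 ((hf a _ _).2 ((hlohi b b).2 rfl))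
  · rintro ⟨a, b⟩ - ⟨a', b'⟩ - hne hd
    have hle : f a (lo b) ⊆ f a' (hi b') := disjoint_compl_right_iff.1 hd
    by_cases haa : a = a'
    · subst haa
      exact hne (congrArg (Prod.mk a) ((hlohi b b').1 ((hf a _ _).1 hle)))
    · exact hunrel a a' haa _ _ hle

/-! ### Separation of the lower and upper estimates -/

theorem gUpper_le_fLower {r n : ℕ} (hr : 3 ≤ r) (hn : r ≤ n) :
    gUpper r n ≤ fLower 0 r (n + 1) := by
  have hterm : (n + 1 - r).choose ((n + 1 - r) / 2) ≤ fLower 0 r (n + 1) := by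
    have h0 : 0 ∈ Finset.range ((n + 1) / r) :=
      Finset.mem_range.2 (Nat.div_pos (by omega) (by omega))
    refine le_trans ?_ (Finset.single_le_sum (fun _ _ => Nat.zero_le _) h0)
    rw [Finset.range_one, Finset.sum_singleton, binom, if_pos (by push_cast; omega)]
    rw [Nat.choose_self, one_mul]
    refine le_of_eq ?_
    congr 1 <;> push_cast <;> omega
  refine le_trans ?_ hterm
  rw [gUpper, fsp, show n + 2 - r = n + 1 - r + 1 by omega]
  generalize hN : n + 1 - r = N
  obtain ⟨k, hk⟩ := Nat.exists_eq_succ_of_ne_zero (show (N + 1) / 2 ≠ 0 by omega)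
  rw [hk, Nat.succ_eq_add_one, Nat.choose_succ_succ']
  have h1 := Nat.choose_le_middle k N
  have h2 := Nat.choose_le_middle (k + 1) N
  omega

end SpernerFD

namespace SpernerFD

/-! ### The minimum of `F4` -/

theorem choose_half_pred (n : ℕ) : (n - 1).choose (n / 2) = (n - 1).choose ((n - 1) / 2) := by
  rcases Nat.even_or_odd' n with ⟨m, rfl | rfl⟩
  · rcases m with _ | m
    · rfl
    · exact Nat.choose_symm_of_eq_add (by omega)
  · congr 1
    omega

theorem factorial_mul_factorial_half_le {n i : ℕ} (hn : 2 ≤ n) (hi : i ≤ n - 1) :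
    (n / 2)! * (n - 1 - n / 2)! ≤ i ! * (n - 1 - i)! := by
  have h1 := Nat.choose_mul_factorial_mul_factorial hi
  have h2 := Nat.choose_mul_factorial_mul_factorial (show n / 2 ≤ n - 1 by omega)
  have h3 : (n - 1).choose i ≤ (n - 1).choose (n / 2) := by
    rw [choose_half_pred]
    exact Nat.choose_le_middle i (n - 1)
  have hpos : 0 < (n - 1).choose i := Nat.choose_pos hi
  refine Nat.le_of_mul_le_mul_left ?_ hpos
  rw [mul_assoc] at h1 h2
  rw [h1, ← h2]
  exact Nat.mul_le_mul_right _ h3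

theorem choose_le_choose_of_le_half {n a b : ℕ} (hab : a ≤ b) (hb : b ≤ n / 2) :
    n.choose a ≤ n.choose b := by
  induction b, hab using Nat.le_induction with
  | base => exact le_rfl
  | succ b hab ih =>
    exact (ih (by omega)).trans (Nat.choose_le_succ_of_lt_half_left (by omega))

theorem factorial_mul_factorial_anti {n a b : ℕ} (hb : b ≤ n)
    (h : n.choose a ≤ n.choose b) (ha : a ≤ n) : b ! * (n - b)! ≤ a ! * (n - a)! := by
  have h1 := Nat.choose_mul_factorial_mul_factorial ha
  have h2 := Nat.choose_mul_factorial_mul_factorial hb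
  rw [mul_assoc] at h1 h2
  refine Nat.le_of_mul_le_mul_left ?_ (Nat.choose_pos ha)
  rw [h1, ← h2]
  exact Nat.mul_le_mul_right _ h

/-- The core of the minimisation. `G` is the least value of i!(n-1-i)!, and b!(n-b)! is `b` times
(b-1)!(n-b)!, so the two copies of the latter on the left can be subtracted from it. -/
theorem two_chain_bound {n a b : ℕ} (hab : a < b) (hb : b < n) :
    (n - 1) * ((n / 2)! * (n - 1 - n / 2)!) + 2 * ((b - 1)! * (n - b)!) ≤
      a ! * (n - a)! + b ! * (n - b)! := by
  obtain ⟨b, rfl⟩ := Nat.exists_eq_succ_of_ne_zero (show b ≠ 0 by omega)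
  rw [Nat.succ_eq_add_one, Nat.add_sub_cancel, Nat.factorial_succ]
  have hG := factorial_mul_factorial_half_le (n := n) (i := b) (by omega) (by omega)
  rw [show n - 1 - b = n - (b + 1) by omega] at hG
  set G := (n / 2)! * (n - 1 - n / 2)! with hGdef
  obtain ⟨k, hk⟩ : ∃ k, n = b + 1 + k := ⟨n - (b + 1), by omega⟩
  rcases le_total b (n / 2) with h | h
  -- Here `b` is already the predecessor of the original one. Below the middle, a!(n-a)! ≥ b!(n-b)!,
  -- and the right side is at least (n-b)+(b+1) = n+1 times b!(n-b-1)!.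
  · have h1 := factorial_mul_factorial_anti (n := n) (b := b) (by omega)
      (choose_le_choose_of_le_half (Nat.lt_succ_iff.1 hab) h) (by omega)
    rw [show n - b = k + 1 by omega, Nat.factorial_succ] at h1
    rw [show n - (b + 1) = k by omega] at hG ⊢
    rw [show n - 1 = b + k by omega]
    nlinarith
  -- Above the middle, a!(n-a)! is at least its central value (n-⌊n/2⌋)G, and the b-1 remaining
  -- multiples of b!(n-b-1)! supply the rest.
  · have h1 := factorial_mul_factorial_anti (n := n) (a := a) (Nat.div_le_self n 2)
      (Nat.choose_le_middle a n) (by omega)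
    rw [show n - n / 2 = (n - 1 - n / 2) + 1 by omega, Nat.factorial_succ,
      show n - 1 - n / 2 + 1 = n - n / 2 by omega] at h1
    obtain ⟨c, rfl⟩ : ∃ c, b = c + 1 := ⟨b - 1, by omega⟩
    have h2 : (n - 1) * G ≤ (n - n / 2) * G + c * G := by
      rw [← add_mul]
      exact Nat.mul_le_mul_right _ (by omega)
    have h3 : c * G ≤ c * ((c + 1)! * (n - (c + 1 + 1))!) := Nat.mul_le_mul_left c hG
    have h4 : (n - n / 2) * G ≤ a ! * (n - a)! := by
      rw [hGdef]
      calc _ = _ := by ring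
        _ ≤ _ := h1
    calc _ ≤ (a ! * (n - a)! + c * ((c + 1)! * (n - (c + 1 + 1))!)) +
          2 * ((c + 1)! * (n - (c + 1 + 1))!) := by omega
      _ = _ := by ring

/-- Equivalently, the binomial coefficient of a+x over a is at least a+x. -/
theorem factorial_mul_factorial_le_pred {a x : ℕ} (ha : 0 < a) (hx : 0 < x) :
    a ! * x ! ≤ (a + x - 1)! := by
  induction x, hx using Nat.le_induction with
  | base => simp
  | succ x hx ih =>
    obtain ⟨k, hk⟩ := Nat.exists_eq_succ_of_ne_zero (show a + x ≠ 0 by omega)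
    rw [hk, Nat.succ_sub_one] at ih
    rw [← add_assoc, Nat.add_sub_cancel, hk, Nat.factorial_succ, Nat.factorial_succ]
    calc a ! * ((x + 1) * x !) = (x + 1) * (a ! * x !) := by ring
      _ ≤ (k + 1) * k ! := Nat.mul_le_mul (by omega) ih

theorem F4_eq (n t : ℕ) (x : Fin 3 → ℕ) : F4 n t x =
    (((t + x 0)! * (n - t - x 0)! : ℕ) + ((t + x 1)! * (n - t - x 1)! : ℕ) +
      ((t + x 2)! * (n - t - x 2)! : ℕ)) +
    (((t + x 0 + x 1)! * (n - t - x 0 - x 1)! : ℕ) +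
      ((t + x 0 + x 2)! * (n - t - x 0 - x 2)! : ℕ) +
      ((t + x 1 + x 2)! * (n - t - x 1 - x 2)! : ℕ)) -
    (((t + x 0)! * (x 1)! * (n - t - x 0 - x 1)! : ℕ) +
      ((t + x 0)! * (x 2)! * (n - t - x 0 - x 2)! : ℕ) +
      ((t + x 1)! * (x 0)! * (n - t - x 1 - x 0)! : ℕ) +
      ((t + x 1)! * (x 2)! * (n - t - x 1 - x 2)! : ℕ) +
      ((t + x 2)! * (x 0)! * (n - t - x 2 - x 0)! : ℕ) +
      ((t + x 2)! * (x 1)! * (n - t - x 2 - x 1)! : ℕ) : ℤ) := by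
  have h1 : (Finset.univ.filter fun q : Fin 3 × Fin 3 => q.1 < q.2) = {(0, 1), (0, 2), (1, 2)} := by
    decide
  have h2 : (Finset.univ.filter fun q : Fin 3 × Fin 3 => q.1 ≠ q.2) =
      {(0, 1), (0, 2), (1, 0), (1, 2), (2, 0), (2, 1)} := by decide
  rw [F4, h1, h2, Fin.sum_univ_three]
  repeat rw [Finset.sum_insert (by decide)]
  rw [Finset.sum_singleton, Finset.sum_singleton]
  push_cast
  ring

/-- The minimum of `F4 n`. -/
def minF4 (n : ℕ) : ℕ := 3 * ((n - 1) * ((n / 2)! * (n - 1 - n / 2)!))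

/-- `two_chain_bound` is applied to both chains from an atom to their common coatom. Summed over the
three pairs, every term of `F4` occurs exactly twice. -/
theorem F4_pair_bound {n t x y : ℕ} (hx : 0 < x) (hy : 0 < y) (h : t + x + y < n) :
    2 * ((n - 1) * ((n / 2)! * (n - 1 - n / 2)!)) + 2 * ((t + x)! * y ! * (n - t - x - y)!) +
      2 * ((t + y)! * x ! * (n - t - y - x)!) ≤ (t + x)! * (n - t - x)! + (t + y)! * (n - t - y)! +
      2 * ((t + x + y)! * (n - t - x - y)!) := by
  have h1 := two_chain_bound (n := n) (a := t + x) (b := t + x + y) (by omega) h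
  have h2 := two_chain_bound (n := n) (a := t + y) (b := t + x + y) (by omega) h
  have h3 := factorial_mul_factorial_le_pred (show 0 < t + x by omega) hy
  have h4 := factorial_mul_factorial_le_pred (show 0 < t + y by omega) hx
  rw [show t + y + x = t + x + y by omega] at h4
  rw [show n - t - y - x = n - t - x - y by omega]
  rw [show n - (t + x) = n - t - x by omega, show n - (t + x + y) = n - t - x - y by omega] at h1
  rw [show n - (t + y) = n - t - y by omega, show n - (t + x + y) = n - t - x - y by omega] at h2
  have h5 := Nat.mul_le_mul_right (n - t - x - y)! h3
  have h6 := Nat.mul_le_mul_right (n - t - x - y)! h4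
  omega

theorem minF4_le_F4 {n t : ℕ} {x : Fin 3 → ℕ} (hx : ∀ j, 0 < x j) (h : t + ∑ j, x j ≤ n) :
    (minF4 n : ℤ) ≤ F4 n t x := by
  rw [Fin.sum_univ_three] at h
  have h0 := hx 0
  have h1 := hx 1
  have h2 := hx 2
  have h01 := F4_pair_bound h0 h1 (show t + x 0 + x 1 < n by omega)
  have h02 := F4_pair_bound h0 h2 (show t + x 0 + x 2 < n by omega)
  have h12 := F4_pair_bound h1 h2 (show t + x 1 + x 2 < n by omega)
  rw [F4_eq, minF4]
  omega

/-- The bound is attained by singletons over a base that puts the atoms on level ⌊n/2⌋. -/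
theorem F4_half {n : ℕ} (hn : 3 ≤ n) : F4 n (n / 2 - 1) (fun _ => 1) = minF4 n := by
  rw [F4_eq, minF4]
  obtain ⟨m, hm⟩ : ∃ m, n / 2 = m + 1 := ⟨n / 2 - 1, by omega⟩
  obtain ⟨k, hk⟩ : ∃ k, n - 1 - n / 2 = k + 1 := ⟨n - 1 - n / 2 - 1, by omega⟩
  have h : n = m + k + 3 := by omega
  rw [hk, hm, Nat.add_sub_cancel, show n - m - 1 = k + 1 + 1 by omega,
    show k + 1 + 1 - 1 = k + 1 by omega, show n - 1 = m + k + 2 by omega]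
  simp only [Nat.factorial_succ]
  push_cast
  ring

theorem M_eq {n : ℕ} (hn : 3 ≤ n) : M n = minF4 n := by
  refine IsLeast.csInf_eq ⟨⟨(n / 2 - 1, fun _ => 1), ⟨fun _ => Nat.one_pos, ?_⟩, F4_half hn⟩, ?_⟩
  · simp
    omega
  · rintro _ ⟨⟨t, x⟩, ⟨hx, h⟩, rfl⟩
    exact minF4_le_F4 hx h

/-! ### Closed forms of the sharper estimate and comparison with `gUpper 3` -/

theorem gStar_eq_div {n : ℕ} (hn : 3 ≤ n) : gStar n = n ! / minF4 n := by
  rw [gStar, M_eq hn, Int.cast_natCast]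
  exact Nat.floor_div_eq_div _ _

theorem gStarStar_eq_div {n : ℕ} (hn : 3 ≤ n) : gStarStar n = n ! / minF4 n := by
  rw [gStarStar, ← Nat.floor_div_eq_div (K := ℚ) (n !) (minF4 n), div_eq_mul_inv]
  congr 3
  obtain ⟨m, hm⟩ : ∃ m, n / 2 = m + 1 := ⟨n / 2 - 1, by omega⟩
  obtain ⟨k, hk⟩ : ∃ k, n - 1 - n / 2 = k + 1 := ⟨n - 1 - n / 2 - 1, by omega⟩
  rw [minF4, hk, hm, show (n + 1) / 2 = k + 1 + 1 by omega, show (n + 2) / 2 = m + 1 + 1 by omega,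
    show (n - 2 + 1) / 2 = k + 1 by omega, show n - 1 = m + k + 2 by omega]
  simp only [Nat.factorial_succ]
  push_cast
  ring

/-- Since (n-1)! is G times a central binomial coefficient, G cancels from the quotient `n ! / minF4
n`. -/
theorem gStarStar_mul_le {n : ℕ} (hn : 3 ≤ n) :
    gStarStar n * (3 * (n - 1)) ≤ n * (n - 1).choose ((n - 1) / 2) := by
  rw [gStarStar_eq_div hn]
  have h1 := Nat.div_mul_le_self (n !) (minF4 n)
  have h2 := Nat.choose_mul_factorial_mul_factorial (show n / 2 ≤ n - 1 by omega)
  rw [choose_half_pred, mul_assoc] at h2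
  generalize n ! / minF4 n = q at h1 ⊢
  rw [minF4, ← Nat.mul_factorial_pred (by omega : n ≠ 0), ← h2] at h1
  have hpos : 0 < (n / 2)! * (n - 1 - n / 2)! := by positivity
  refine Nat.le_of_mul_le_mul_right ?_ hpos
  calc _ = _ := by ring
    _ ≤ _ := h1
    _ = _ := by ring

theorem gStarStar_le_gUpper {n : ℕ} (hn : 3 ≤ n) : gStarStar n ≤ gUpper 3 n := by
  have h := gStarStar_mul_le hn
  rw [gUpper, fsp, show n + 2 - 3 = n - 1 by omega, Nat.le_div_iff_mul_le two_pos]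
  generalize (n - 1).choose ((n - 1) / 2) = c at h ⊢
  obtain ⟨k, rfl⟩ : ∃ k, n = k + 3 := ⟨n - 3, by omega⟩
  rw [show k + 3 - 1 = k + 2 by omega] at h
  have hpos : 0 < 3 * (k + 2) := by omega
  refine Nat.le_of_mul_le_mul_right ?_ hpos
  nlinarith

theorem gStarStar_lt_gUpper {n : ℕ} (hn : 5 ≤ n) : gStarStar n < gUpper 3 n := by
  rcases Nat.lt_or_ge n 7 with h7 | h7
  · rw [gStarStar_eq_div (by omega)]
    interval_cases n <;> decide
  have h := gStarStar_mul_le (show 3 ≤ n by omega)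
  rw [gUpper, fsp, show n + 2 - 3 = n - 1 by omega, Nat.lt_iff_add_one_le,
    Nat.le_div_iff_mul_le two_pos]
  -- Strictness requires c(n-3) ≥ 6(n-1), where c is the central coefficient; c ≥ 20 gives it from n
  -- = 7 on, and n = 5, 6 are computed.
  have hc : 20 ≤ (n - 1).choose ((n - 1) / 2) :=
    calc 20 = Nat.choose 6 3 := rfl
      _ ≤ (n - 1).choose 3 := Nat.choose_le_choose 3 (by omega)
      _ ≤ _ := Nat.choose_le_middle 3 (n - 1)
  generalize (n - 1).choose ((n - 1) / 2) = c at h hc ⊢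
  obtain ⟨k, rfl⟩ : ∃ k, n = k + 7 := ⟨n - 7, by omega⟩
  rw [show k + 7 - 1 = k + 6 by omega] at h
  have hpos : 0 < 3 * (k + 6) := by omega
  refine Nat.le_of_mul_le_mul_right ?_ hpos
  nlinarith

end SpernerFD

namespace SpernerFD

/-! ### Counting the numberings that pass through a copy of `FSP(3, 0, 3)` -/

open Numbering

/-- A numbering with prefix `t` splits into numberings of `t` and of its complement; the prefix `s`
constrains only the first. -/
theorem card_prefixed_inter_prefixed_le {α : Type*} [Fintype α] [DecidableEq α] {s t : Finset α}
    (hst : s ⊆ t) : (prefixed s ∩ prefixed t).card ≤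
      (s.card)! * (t.card - s.card)! * (Fintype.card α - t.card)! := by
  let s' : Finset t := s.subtype (· ∈ t)
  have hs' : s'.card = s.card := by
    rw [Finset.card_subtype, Finset.filter_true_of_mem hst]
  have hcard : ((prefixed s') ×ˢ (Finset.univ : Finset (Numbering ↑(tᶜ)))).card =
      (s.card)! * (t.card - s.card)! * (Fintype.card α - t.card)! := by
    rw [Finset.card_product, card_prefixed, hs', Fintype.card_coe, Finset.card_univ,
      Fintype.card_numbering, Fintype.card_coe, Finset.card_compl]
  rw [← hcard]
  refine Finset.card_le_card_of_injOn
    (fun f => if h : f ∈ prefixed t then prefixedEquiv t ⟨f, h⟩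
      -- A dummy value, never taken on the intersection.
      else (Fintype.equivFin _, Fintype.equivFin _)) ?_ ?_
  · intro f hf
    obtain ⟨hfs, hft⟩ := Finset.mem_inter.1 (Finset.mem_coe.1 hf)
    beta_reduce
    rw [dif_pos hft]
    refine Finset.mem_coe.2 (Finset.mem_product.2 ⟨mem_prefixed.2 fun x => ?_, Finset.mem_univ _⟩)
    rw [hs', Finset.mem_subtype, mem_prefixed.1 hfs x]
    rfl
  · intro f hf g hg h
    have hft := (Finset.mem_inter.1 (Finset.mem_coe.1 hf)).2
    have hgt := (Finset.mem_inter.1 (Finset.mem_coe.1 hg)).2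
    dsimp only at h
    rw [dif_pos hft, dif_pos hgt] at h
    exact congrArg Subtype.val ((prefixedEquiv t).injective h)

variable {n : ℕ}

/-- The numberings that have a prefix of the form `T ∪ X j`. -/
def throughAtoms (T : Finset (Fin n)) (X : Fin 3 → Finset (Fin n)) :
    Finset (Numbering (Fin n)) :=
  Finset.univ.biUnion fun j => prefixed (T ∪ X j)

/-- The numberings that have a prefix of the form `T ∪ X j ∪ X u` with `j < u`. -/
def throughCoatoms (T : Finset (Fin n)) (X : Fin 3 → Finset (Fin n)) :
    Finset (Numbering (Fin n)) :=
  {q : Fin 3 × Fin 3 | q.1 < q.2}.toFinset.biUnion fun q => prefixed (T ∪ X q.1 ∪ X q.2)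

/-- The sets `T` and `X j` are pairwise disjoint, and the sets `X j` are nonempty. -/
structure IsCrown (T : Finset (Fin n)) (X : Fin 3 → Finset (Fin n)) : Prop where
  nonempty (j) : (X j).Nonempty
  disjoint_left (j) : Disjoint T (X j)
  disjoint (j u) : j ≠ u → Disjoint (X j) (X u)

namespace IsCrown

variable {T : Finset (Fin n)} {X : Fin 3 → Finset (Fin n)}

theorem card_atom (h : IsCrown T X) (j : Fin 3) : (T ∪ X j).card = T.card + (X j).card :=
  Finset.card_union_of_disjoint (h.disjoint_left j)

theorem card_coatom (h : IsCrown T X) {j u : Fin 3} (hju : j ≠ u) :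
    (T ∪ X j ∪ X u).card = T.card + (X j).card + (X u).card := by
  rw [Finset.card_union_of_disjoint
    (Finset.disjoint_union_left.2 ⟨h.disjoint_left u, h.disjoint j u hju⟩), h.card_atom]

theorem not_atom_subset (h : IsCrown T X) {j u v : Fin 3} (hu : j ≠ u) (hv : j ≠ v) :
    ¬ T ∪ X j ⊆ T ∪ X u ∪ X v := by
  obtain ⟨x, hx⟩ := h.nonempty j
  intro hle
  have := hle (Finset.mem_union_right T hx)
  rw [Finset.mem_union, Finset.mem_union] at this
  rcases this with (hm | hm) | hm
  · exact Finset.disjoint_left.1 (h.disjoint_left j) hm hx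
  · exact Finset.disjoint_left.1 (h.disjoint j u hu) hx hm
  · exact Finset.disjoint_left.1 (h.disjoint j v hv) hx hm

theorem card_add_sum_le (h : IsCrown T X) : T.card + ∑ j, (X j).card ≤ n := by
  rw [← Finset.card_biUnion fun j _ u _ hju => h.disjoint j u hju,
    ← Finset.card_union_of_disjoint]
  · simpa using Finset.card_le_univ (T ∪ Finset.univ.biUnion X)
  · exact (Finset.disjoint_biUnion_right _ _ _).2 fun j _ => h.disjoint_left j

theorem card_throughAtoms (h : IsCrown T X) : (throughAtoms T X).card =
    ∑ j, (T.card + (X j).card)! * (n - T.card - (X j).card)! := by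
  rw [throughAtoms, Finset.card_biUnion]
  · refine Finset.sum_congr rfl fun j _ => ?_
    rw [card_prefixed, h.card_atom, Fintype.card_fin, Nat.sub_add_eq]
  · intro j _ u _ hju
    refine disjoint_prefixed_prefixed (fun hle => ?_) (fun hle => ?_)
    · exact h.not_atom_subset hju hju (hle.trans Finset.subset_union_left)
    · exact h.not_atom_subset hju.symm hju.symm (hle.trans Finset.subset_union_left)

theorem card_throughCoatoms (h : IsCrown T X) : (throughCoatoms T X).card =
    ∑ q : Fin 3 × Fin 3 with q.1 < q.2, (T.card + (X q.1).card + (X q.2).card)! *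
      (n - T.card - (X q.1).card - (X q.2).card)! := by
  have hset : {q : Fin 3 × Fin 3 | q.1 < q.2}.toFinset =
    Finset.univ.filter fun q : Fin 3 × Fin 3 => q.1 < q.2 := by ext; simp
  have hle : ∀ q q' : Fin 3 × Fin 3, q.1 < q.2 → q'.1 < q'.2 → q ≠ q' →
      ¬ T ∪ X q.1 ∪ X q.2 ⊆ T ∪ X q'.1 ∪ X q'.2 := by
    intro q q' hq hq' hne hsub
    have hcase : (q.1 ≠ q'.1 ∧ q.1 ≠ q'.2) ∨ (q.2 ≠ q'.1 ∧ q.2 ≠ q'.2) := by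
      have hne' : ¬ (q.1 = q'.1 ∧ q.2 = q'.2) := fun e => hne (Prod.ext e.1 e.2)
      omega
    rcases hcase with hc | hc
    · exact h.not_atom_subset hc.1 hc.2 (Finset.subset_union_left.trans hsub)
    · refine h.not_atom_subset hc.1 hc.2 (Finset.Subset.trans ?_ hsub)
      exact Finset.union_subset_union_left Finset.subset_union_left
  rw [throughCoatoms, hset, Finset.card_biUnion]
  · refine Finset.sum_congr rfl fun q hq => ?_
    rw [card_prefixed, h.card_coatom (Finset.mem_filter.1 hq).2.ne, Fintype.card_fin,
      Nat.sub_add_eq, Nat.sub_add_eq]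
  · intro q hq q' hq' hne
    have hq := (Finset.mem_filter.1 (Finset.mem_coe.1 hq)).2
    have hq' := (Finset.mem_filter.1 (Finset.mem_coe.1 hq')).2
    exact disjoint_prefixed_prefixed (hle q q' hq hq' hne) (hle q' q hq' hq hne.symm)

/-- Two prefixes of one numbering are comparable, so an atom and a coatom can share a numbering only
if the atom lies below the coatom. -/
theorem card_inter_le (h : IsCrown T X) : (throughAtoms T X ∩ throughCoatoms T X).card ≤
    ∑ q : Fin 3 × Fin 3 with q.1 ≠ q.2, (T.card + (X q.1).card)! * ((X q.2).card)! *
      (n - T.card - (X q.1).card - (X q.2).card)! := by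
  have hsub : throughAtoms T X ∩ throughCoatoms T X ⊆
      (Finset.univ.filter fun q : Fin 3 × Fin 3 => q.1 ≠ q.2).biUnion fun q =>
        prefixed (T ∪ X q.1) ∩ prefixed (T ∪ X q.1 ∪ X q.2) := by
    intro σ hσ
    obtain ⟨h1, h2⟩ := Finset.mem_inter.1 hσ
    obtain ⟨j, -, hj⟩ := Finset.mem_biUnion.1 h1
    obtain ⟨⟨u, v⟩, huv, hq⟩ := Finset.mem_biUnion.1 h2
    have huv : u < v := by simpa using huv
    dsimp only at hq
    rw [Finset.mem_biUnion]
    by_cases hju : j = u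
    · subst hju
      exact ⟨(j, v), by simp [huv.ne], Finset.mem_inter.2 ⟨hj, hq⟩⟩
    by_cases hjv : j = v
    · subst hjv
      exact ⟨(j, u), by simp [hju], Finset.mem_inter.2 ⟨hj, by
        rwa [Finset.union_right_comm]⟩⟩
    · refine absurd hq (Finset.disjoint_left.1 (disjoint_prefixed_prefixed
        (h.not_atom_subset hju hjv) fun hle => ?_) hj)
      exact h.not_atom_subset (v := j) (Ne.symm hju) (Ne.symm hju)
        ((Finset.subset_union_left.trans hle).trans Finset.subset_union_left)
  refine (Finset.card_le_card hsub).trans (Finset.card_biUnion_le.trans ?_)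
  refine Finset.sum_le_sum fun q hq => ?_
  refine (card_prefixed_inter_prefixed_le Finset.subset_union_left).trans (le_of_eq ?_)
  rw [h.card_coatom (Finset.mem_filter.1 hq).2, h.card_atom, Fintype.card_fin,
    Nat.add_sub_cancel_left, Nat.sub_add_eq, Nat.sub_add_eq]

theorem F4_le_card (h : IsCrown T X) :
    F4 n T.card (fun j => (X j).card) ≤ ((throughAtoms T X ∪ throughCoatoms T X).card : ℤ) := by
  have h1 := Finset.card_union_add_card_inter (throughAtoms T X) (throughCoatoms T X)
  have h2 := h.card_inter_le
  rw [h.card_throughAtoms, h.card_throughCoatoms] at h1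
  rw [F4]
  zify at h1 h2
  linarith

end IsCrown

/-- A copy need not be a crown itself: coatom images may exceed unions of atom images. Sets lying
between members of the copy suffice for disjointness. -/
theorem exists_crown_between {f : FSP 3 0 3 → Finset (Fin n)}
    (hf : ∀ X Y, f X ⊆ f Y ↔ X ≤ Y) : ∃ T X, IsCrown T X ∧
      ∀ σ ∈ throughAtoms T X ∪ throughCoatoms T X,
        ∃ P Z Q, f P ⊆ Z ∧ Z ⊆ f Q ∧ σ ∈ prefixed Z := by
  let at' : Fin 3 → FSP 3 0 3 := fun j => ⟨{j}, by simp, by simp⟩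
  let co : Fin 3 → FSP 3 0 3 := fun j => ⟨{j}ᶜ, by decide +revert, by decide +revert⟩
  have hatco : ∀ j u, j ≠ u → f (at' j) ⊆ f (co u) := by
    intro j u hju
    rw [hf]
    change {j} ⊆ ({u}ᶜ : Finset (Fin 3))
    simpa using hju.symm
  let A : Fin 3 → Finset (Fin n) := fun j => f (at' j)
  -- Points in at least two atom images: for each coatom, one of those two atoms lies below it, so
  -- `T` lies in every coatom image.
  let T : Finset (Fin n) := {x | ∃ j u, j ≠ u ∧ x ∈ A j ∧ x ∈ A u}
  have hT : ∀ x, x ∈ T ↔ ∃ j u, j ≠ u ∧ x ∈ A j ∧ x ∈ A u := fun x => by simp [T]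
  have hTco : ∀ j, T ⊆ f (co j) := by
    intro j x hx
    obtain ⟨u, v, huv, hu, hv⟩ := (hT x).1 hx
    by_cases huj : u = j
    · exact hatco v j (fun h => huv (huj.trans h.symm)) hv
    · exact hatco u j huj hu
  have hTX : ∀ j, T ∪ A j \ T = T ∪ A j := fun j => Finset.union_sdiff_self_eq_union
  refine ⟨T, fun j => A j \ T, ⟨fun j => ?_, fun j => Finset.disjoint_sdiff, fun j u hju => ?_⟩, ?_⟩
  · have hnot : ¬ A j ⊆ f (co j) := by
      rw [hf]
      change ¬ {j} ⊆ ({j}ᶜ : Finset (Fin 3))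
      simp
    obtain ⟨x, hx, hx'⟩ := Finset.not_subset.1 hnot
    exact ⟨x, Finset.mem_sdiff.2 ⟨hx, fun h => hx' (hTco j h)⟩⟩
  · rw [Finset.disjoint_left]
    intro x hx hx'
    rw [Finset.mem_sdiff] at hx hx'
    exact hx.2 ((hT x).2 ⟨j, u, hju, hx.1, hx'.1⟩)
  · intro σ hσ
    rcases Finset.mem_union.1 hσ with h | h
    · obtain ⟨j, -, hj⟩ := Finset.mem_biUnion.1 h
      obtain ⟨u, hu⟩ : ∃ u, j ≠ u := (exists_ne j).imp fun _ => Ne.symm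
      refine ⟨at' j, _, co u, ?_, ?_, hj⟩
      · rw [hTX]
        exact Finset.subset_union_right
      · rw [hTX]
        exact Finset.union_subset (hTco u) (hatco j u hu)
    · obtain ⟨⟨u, v⟩, -, hq⟩ := Finset.mem_biUnion.1 h
      obtain ⟨w, hu, hv⟩ : ∃ w, u ≠ w ∧ v ≠ w :=
        (by decide : ∀ u v : Fin 3, ∃ w, u ≠ w ∧ v ≠ w) u v
      refine ⟨at' u, _, co w, ?_, ?_, hq⟩
      · dsimp only
        rw [hTX]
        exact Finset.subset_union_right.trans Finset.subset_union_left
      · dsimp only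
        rw [hTX]
        exact Finset.union_subset (Finset.union_subset (hTco w) (hatco u w hu))
          (Finset.sdiff_subset.trans (hatco v w hv))

theorem Sp_FSP_mul_minF4_le (n : ℕ) : Sp (FSP 3 0 3) n * minF4 n ≤ n ! := by
  obtain ⟨f, hf, hunrel⟩ := exists_unrelated_copies (FSP 3 0 3) n
  choose T X hcrown hbetween using fun a => exists_crown_between (hf a)
  have hdisj : ∀ a b, a ≠ b → Disjoint (throughAtoms (T a) (X a) ∪ throughCoatoms (T a) (X a))
      (throughAtoms (T b) (X b) ∪ throughCoatoms (T b) (X b)) := by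
    intro a b hab
    refine Finset.disjoint_left.2 fun σ ha hb => ?_
    obtain ⟨P, Z, Q, hP, hQ, hZ⟩ := hbetween a σ ha
    obtain ⟨P', Z', Q', hP', hQ', hZ'⟩ := hbetween b σ hb
    exact Finset.disjoint_left.1 (disjoint_prefixed_prefixed
      (fun h => hunrel a b hab P Q' ((hP.trans h).trans hQ'))
      (fun h => hunrel b a hab.symm P' Q ((hP'.trans h).trans hQ))) hZ hZ'
  calc Sp (FSP 3 0 3) n * minF4 n = ∑ _a : Fin (Sp (FSP 3 0 3) n), minF4 n := by simp
    _ ≤ ∑ a, (throughAtoms (T a) (X a) ∪ throughCoatoms (T a) (X a)).card := by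
      refine Finset.sum_le_sum fun a _ => ?_
      have h := minF4_le_F4 (n := n) (fun j => Finset.card_pos.2 ((hcrown a).nonempty j))
        (hcrown a).card_add_sum_le
      exact_mod_cast h.trans (hcrown a).F4_le_card
    _ = (Finset.univ.biUnion fun a =>
        throughAtoms (T a) (X a) ∪ throughCoatoms (T a) (X a)).card :=
      (Finset.card_biUnion fun a _ b _ hab => hdisj a b hab).symm
    _ ≤ n ! := by
      refine (Finset.card_le_univ _).trans (le_of_eq ?_)
      rw [Fintype.card_numbering, Fintype.card_fin]

theorem minF4_pos {n : ℕ} (hn : 2 ≤ n) : 0 < minF4 n := by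
  have : 0 < n - 1 := by omega
  unfold minF4
  positivity

theorem Sp_FSP_le_gStar {n : ℕ} (hn : 3 ≤ n) : Sp (FSP 3 0 3) n ≤ gStar n := by
  rw [gStar_eq_div hn, Nat.le_div_iff_mul_le (minF4_pos (by omega))]
  exact Sp_FSP_mul_minF4_le n

end SpernerFD

theorem theorem4p1 :
    (∀ r : ℕ, 3 ≤ r →
      (∀ n : ℕ, r ≤ n → Sp (FSP r 0 r) n = Sp (Jir (FD r)) n) ∧
      (∀ p : ℤ, -(r : ℤ) ≤ p → p ≤ (r : ℤ) →
        IsLowerEstimateOn (Jir (FD r)) (fLower p r) (Set.Ici r)) ∧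
      IsUpperEstimateOn (Jir (FD r)) (gUpper r) (Set.Ici r) ∧
      (∀ n : ℕ, r ≤ n →
        fLower 0 r n ≤ Sp (Jir (FD r)) n ∧ Sp (Jir (FD r)) n ≤ gUpper r n)) ∧
    IsUpperEstimateOn (Jir (FD 3)) gStar (Set.Ici 3) ∧
    (∀ n ∈ Set.Icc 3 300, gStar n = gStarStar n ∧ gStarStar n ≤ gUpper 3 n) ∧
    (∀ n ∈ Set.Icc 5 300, gStarStar n < gUpper 3 n) ∧
    IsSeparatedOn (Jir (FD 3)) (fLower 0 3) (gUpper 3) (Set.Ici 3) ∧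
    IsSeparatedOn (Jir (FD 3)) (fLower 0 3) gStarStar (Set.Icc 3 300) ∧
    IsSeparatedOn (Jir (FD 3)) (fLower 0 3) gStar (Set.Icc 3 300) ∧
    (∀ r ∈ Set.Icc 3 100,
      IsSeparatedOn (Jir (FD r)) (fLower 0 r) (gUpper r) (Set.Icc r 300)) := by
  have hlower : ∀ (p : ℤ) (r n : ℕ), 3 ≤ r → fLower p r n ≤ Sp (Jir (FD r)) n :=
    fun p r n hr => Sp_FSP_eq_Sp_Jir r n ▸ fLower_le_Sp_FSP p (by omega) n
  have hupper : ∀ r n : ℕ, 3 ≤ r → r ≤ n → Sp (Jir (FD r)) n ≤ gUpper r n :=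
    fun r n hr hn => Sp_FSP_eq_Sp_Jir r n ▸ Sp_FSP_le_gUpper hr hn
  have hstar : ∀ n : ℕ, 3 ≤ n → Sp (Jir (FD 3)) n ≤ gStar n :=
    fun n hn => Sp_FSP_eq_Sp_Jir 3 n ▸ Sp_FSP_le_gStar hn
  have heq : ∀ n : ℕ, 3 ≤ n → gStar n = gStarStar n :=
    fun n hn => (gStar_eq_div hn).trans (gStarStar_eq_div hn).symm
  have hsep : ∀ n : ℕ, 3 ≤ n → gStarStar n ≤ fLower 0 3 (n + 1) :=
    fun n hn => (gStarStar_le_gUpper hn).trans (gUpper_le_fLower le_rfl hn)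
  refine ⟨fun r hr => ⟨fun n _ => Sp_FSP_eq_Sp_Jir r n, fun p _ _ n _ => hlower p r n hr,
    fun n hn => hupper r n hr hn, fun n hn => ⟨hlower 0 r n hr, hupper r n hr hn⟩⟩,
    fun n hn => hstar n hn, fun n hn => ⟨heq n hn.1, gStarStar_le_gUpper hn.1⟩,
    fun n hn => gStarStar_lt_gUpper hn.1,
    ⟨fun n _ => hlower 0 3 n le_rfl, fun n hn => hupper 3 n le_rfl hn,
      fun n hn => gUpper_le_fLower le_rfl hn⟩,
    ⟨fun n _ => hlower 0 3 n le_rfl, fun n hn => heq n hn.1 ▸ hstar n hn.1,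
      fun n hn => hsep n hn.1⟩,
    ⟨fun n _ => hlower 0 3 n le_rfl, fun n hn => hstar n hn.1,
      fun n hn => heq n hn.1 ▸ hsep n hn.1⟩,
    fun r hr => ⟨fun n _ => hlower 0 r n hr.1, fun n hn => hupper r n hr.1 hn.1,
      fun n hn => gUpper_le_fLower hr.1 hn.1⟩⟩
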